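/- Let $G$ be a locally compact (Hausdorff) group with left Haar measure $\lambda$. Let $M(G)$ be the measure algebra of complex regular Borel measures on $G$, with convolution given by $\int g\,d(\mu*\nu)=\int\!\int g(xy)\,d\mu(x)\,d\nu(y)$ for $g\in C_0(G)$, and let $M_a(G)=\{\sigma\in M(G): |\sigma|\ll\lambda\}$. A generalised function on $G$ is a family $f=(f_\mu)_{\mu\in M(G)}\in\prod_{\mu\in M(G)}L^\infty(|\mu|)$ such that $f_\mu=f_\nu$ $|\mu|$-a.e. whenever $|\mu|\ll|\nu|$. Let $GL(G)$ be the space of all generalised functions, and for $f\in GL(G)$ and $\mu\in M(G)$ put $\langle f,\mu\rangle=\int_G f_\mu\,d\mu$. Let $GL_0(G)$ be the set of all $f\in GL(G)$ that vanish at infinity: for each $\varepsilon>0$ there is a compact set $K\subseteq G$ such that for all $\mu\in M(G)$, $|f_\mu(x)|<\varepsilon$ for $|\mu|$-almost all $x\in G\setminus K$. View $C_0(G)$ as a subset of $GL(G)$ by identifying $h\in C_0(G)$ with the family whose $\mu$-th coordinate is the class of $h$ in $L^\infty(|\mu|)$. For $\zeta\in M(G)$ and $f\in GL(G)$, let $\zeta\circ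 f$ and $f\circ\zeta$ denote the generalised functions determined by $$\langle \zeta\circ f,\mu\rangle=\langle f,\zeta*\mu\rangle,\qquad \langle f\circ\zeta,\mu\rangle=\langle f,\mu*\zeta\rangle\qquad(\mu\in M(G)).$$ Then, for $\sigma\in M_a(G)$ and $f\in GL_0(G)$, the generalised functions $\sigma\circ f$ and $f\circ\sigma$ exist and are unique, and (i) $M_a(G)\circ GL_0(G):=\{\sigma\circ f:\ \sigma\in M_a(G),\ f\in GL_0(G)\}=C_0(G)$; (ii) $GL_0(G)\circ M_a(G):=\{f\circ\sigma:\ f\in GL_0(G),\ \sigma\in M_a(G)\}=C_0(G)$. -/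

import Mathlib

open MeasureTheory
open scoped ENNReal ZeroAtInfty

noncomputable section

/-- The set underlying the measure algebra `M(G)`: the complex Borel measures on `G` whose total
variation `|μ|` is a regular measure. -/
structure RegularComplexMeasure (G : Type*) [TopologicalSpace G] [MeasurableSpace G] where
  toComplexMeasure : ComplexMeasure G
  regular : toComplexMeasure.variation.Regular

namespace RegularComplexMeasure

variable {G : Type*} [TopologicalSpace G] [MeasurableSpace G]

/-- The total variation measure `|μ|`. -/
abbrev tv (μ : RegularComplexMeasure G) : Measure G := μ.toComplexMeasure.variation

/-- The integral `∫ g dμ` of a complex function against a complex measure. -/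
def integral (μ : RegularComplexMeasure G) (g : G → ℂ) : ℂ :=
  VectorMeasure.integral μ.toComplexMeasure g (ContinuousLinearMap.mul ℝ ℂ)

/-- `IsConvolution μ ν ρ` says that `ρ = μ * ν` in `M(G)`, i.e. that
`∫ g dρ = ∫ ∫ g (x y) dμ(x) dν(y)` for all `g ∈ C₀(G)`. The measure `ρ` is determined by this, since
`M(G)` is the dual space of `C₀(G)`. -/
def IsConvolution [Mul G] (μ ν ρ : RegularComplexMeasure G) : Prop :=
  ∀ g : C₀(G, ℂ), ρ.integral g = ν.integral fun y => μ.integral fun x => g (x * y)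

/-- `M_a(G)`: the measures in `M(G)` that are absolutely continuous with respect to the positive
measure `haar`. -/
def absolutelyContinuousMeasures (haar : Measure G) : Set (RegularComplexMeasure G) :=
  {σ | σ.tv ≪ haar}

end RegularComplexMeasure

/-- A generalised function on `G`: a family `(f_μ)` in `∏ L^∞(|μ|)`, indexed by `μ ∈ M(G)`, with
`f_μ = f_ν` `|μ|`-almost everywhere whenever `|μ| ≪ |ν|`. This is `GL(G)`. -/
@[ext]
structure GeneralisedFunction (G : Type*) [TopologicalSpace G] [MeasurableSpace G] where
  toFun : ∀ μ : RegularComplexMeasure G, Lp ℂ ∞ μ.tv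
  compatible : ∀ μ ν : RegularComplexMeasure G, μ.tv ≪ ν.tv → toFun μ =ᵐ[μ.tv] toFun ν

namespace GeneralisedFunction

variable {G : Type*} [TopologicalSpace G] [MeasurableSpace G]

/-- The duality `⟨f, μ⟩ = ∫ f_μ dμ` between `GL(G)` and `M(G)`. -/
def pairing (f : GeneralisedFunction G) (μ : RegularComplexMeasure G) : ℂ :=
  μ.integral (f.toFun μ)

/-- `GL₀(G)`: the generalised functions that vanish at infinity. -/
def vanishingAtInfinity (G : Type*) [TopologicalSpace G] [MeasurableSpace G] :
    Set (GeneralisedFunction G) :=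
  {f | ∀ ε : ℝ, 0 < ε → ∃ K : Set G, IsCompact K ∧
    ∀ μ : RegularComplexMeasure G, ∀ᵐ x ∂μ.tv, x ∉ K → ‖f.toFun μ x‖ < ε}

lemma memLp_top_C₀ [BorelSpace G] (h : C₀(G, ℂ)) (m : Measure G) : MemLp h ∞ m :=
  memLp_top_of_bound h.continuous.aestronglyMeasurable ‖h.toBCF‖
    (Filter.Eventually.of_forall fun x => h.toBCF.norm_coe_le_norm x)

/-- The embedding of `C₀(G)` into `GL(G)`: each coordinate of the image of `h` is the class
of `h`. -/
def ofC₀ [BorelSpace G] (h : C₀(G, ℂ)) : GeneralisedFunction G where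
  toFun μ := (memLp_top_C₀ h μ.tv).toLp h
  compatible μ ν hμν := (memLp_top_C₀ h μ.tv).coeFn_toLp.trans
    (hμν.ae_eq (memLp_top_C₀ h ν.tv).coeFn_toLp).symm

/-- `IsLeftProduct ζ f g` says that `g = ζ ∘ f`, i.e. that `g` is the generalised function which
corresponds to the functional `μ ↦ ⟨f, ζ * μ⟩` on `M(G)`. -/
def IsLeftProduct [Mul G] (ζ : RegularComplexMeasure G) (f g : GeneralisedFunction G) : Prop :=
  ∀ μ, ∃ ρ, RegularComplexMeasure.IsConvolution ζ μ ρ ∧ g.pairing μ = f.pairing ρ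

/-- `IsRightProduct f ζ g` says that `g = f ∘ ζ`, i.e. that `g` is the generalised function which
corresponds to the functional `μ ↦ ⟨f, μ * ζ⟩` on `M(G)`. -/
def IsRightProduct [Mul G] (f : GeneralisedFunction G) (ζ : RegularComplexMeasure G)
    (g : GeneralisedFunction G) : Prop :=
  ∀ μ, ∃ ρ, RegularComplexMeasure.IsConvolution μ ζ ρ ∧ g.pairing μ = f.pairing ρ

/-- `S ∘ T = {ζ ∘ f : ζ ∈ S, f ∈ T}`. -/
def leftProducts [Mul G] (S : Set (RegularComplexMeasure G)) (T : Set (GeneralisedFunction G)) :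
    Set (GeneralisedFunction G) :=
  {g | ∃ ζ ∈ S, ∃ f ∈ T, IsLeftProduct ζ f g}

/-- `T ∘ S = {f ∘ ζ : f ∈ T, ζ ∈ S}`. -/
def rightProducts [Mul G] (T : Set (GeneralisedFunction G)) (S : Set (RegularComplexMeasure G)) :
    Set (GeneralisedFunction G) :=
  {g | ∃ f ∈ T, ∃ ζ ∈ S, IsRightProduct f ζ g}

end GeneralisedFunction

end

/-!
Let `ν` be a left invariant regular measure on `G`. A measure `σ ≪ ν` has a density `k ∈ L¹(ν)`
(`RegularComplexMeasure.exists_eq_ofDensity`), even though `ν` need not be `σ`-finite. The point of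
the proof is that translation `x ↦ δ_x * k` is continuous into `L¹(ν)`, so that for `μ ∈ M(G)` the
convolution `μ * σ` is the Bochner integral `∫ δ_x * k dμ(x)`, again a member of `L¹(ν)`.

A generalised function `f` which vanishes at infinity has uniformly bounded coordinates on `L¹(ν)`
(`GeneralisedFunction.exists_bound`), so it restricts to a bounded linear functional there. Hence
`h(x) = ⟨f, δ_x * k⟩` is continuous, it vanishes at infinity because `f` does and `k` is
concentrated on a compact set (`exists_C₀_pairing_translateL1`), and applying the functional under
the Bochner integral yields `⟨f, μ * σ⟩ = ∫ h dμ` (`exists_convolution_pairing_eq`). So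
`f ∘ σ = h ∈ C₀(G)`. Uniqueness of the products holds because `C₀(G)` separates `M(G)` and `M(G)`
separates generalised functions.

Conversely, `L¹(ν)` acts on `C₀(G)` by `f ∘ σ = ∫ k(x) f(· x) dν(x)`, and the normalised indicator
functions of small neighbourhoods of `1` are approximate units of norm one. By Cohen's factorization
theorem (`exists_cohen_factorization`) every `h ∈ C₀(G)` is of the form `f ∘ σ` with `σ ≪ ν` and
even `f ∈ C₀(G)`.

The products `σ ∘ f` are the products `f ∘ σ` for the opposite group. Its left Haar measure is the
right Haar measure of `G`, and absolute continuity with respect to either of them is the same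
condition (`absolutelyContinuous_inv_iff`).
-/

noncomputable section

open Filter Set Topology
open scoped NNReal Pointwise

/-! ### Complex measures with a density -/

section Densities

variable {X : Type*} [MeasurableSpace X]

lemma isFiniteMeasure_withDensity_enorm {m : Measure X} {p : X → ℂ} (hp : Integrable p m) :
    IsFiniteMeasure (m.withDensity fun x => ‖p x‖ₑ) :=
  ⟨by simpa using! hp.2⟩

lemma ae_withDensity_enorm_iff {m : Measure X} {p : X → ℂ} (hp : Integrable p m) {P : X → Prop} :
    (∀ᵐ x ∂m.withDensity fun x => ‖p x‖ₑ, P x) ↔ ∀ᵐ x ∂m, p x ≠ 0 → P x := by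
  rw [ae_withDensity_iff' hp.aestronglyMeasurable.enorm]
  simp

/-- A finite measure with an integrable density with respect to a regular measure is regular. -/
lemma regular_withDensity_enorm [TopologicalSpace X] [T2Space X] [LocallyCompactSpace X]
    [BorelSpace X] {m : Measure X} [m.Regular] {p : X → ℂ} (hp : Integrable p m) :
    (m.withDensity fun x => ‖p x‖ₑ).Regular := by
  have hfin := isFiniteMeasure_withDensity_enorm hp
  suffices h : (m.withDensity fun x => ‖p x‖ₑ).InnerRegularCompactLTTop from inferInstance
  obtain ⟨w, hw, hpw⟩ : ∃ w : X → ℝ≥0∞, Measurable w ∧ (fun x => ‖p x‖ₑ) =ᵐ[m] w :=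
    ⟨_, hp.aestronglyMeasurable.enorm.measurable_mk, hp.aestronglyMeasurable.enorm.ae_eq_mk⟩
  have hwint : ∫⁻ x, w x ∂m ≠ ∞ := by
    rw [← lintegral_congr_ae hpw]
    exact hp.2.ne
  rw [withDensity_congr_ae hpw] at hfin ⊢
  refine ⟨fun A hA r hr => ?_⟩
  obtain ⟨u, hanti, hu0, hu⟩ := exists_seq_strictAnti_tendsto' (zero_lt_one' ℝ≥0∞)
  -- The density is supported on the union of the sets `{u n < w}`, which have finite `m`-measure,
  -- so that the regularity of `m` applies to them.
  have hmono : (m.withDensity w) A ≤ ⨆ n, (m.withDensity w) (A ∩ {x | u n < w x}) := by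
    have hinc : Monotone fun n => A ∩ {x | u n < w x} := fun i j hij x hx =>
      ⟨hx.1, (hanti.antitone hij).trans_lt hx.2⟩
    rw [← hinc.measure_iUnion]
    have hzero : (m.withDensity w) {x | w x = 0} = 0 := by
      rw [show {x | w x = 0} = w ⁻¹' {0} from rfl,
        withDensity_apply _ (hw (measurableSet_singleton 0)),
        setLIntegral_congr_fun (g := fun _ => 0) (hw (measurableSet_singleton 0))
          (fun x hx => hx)]
      simp
    rw [← add_zero ((m.withDensity w) (⋃ n, A ∩ {x | u n < w x})), ← hzero]
    refine (measure_mono fun x (hx : x ∈ A) => ?_).trans (measure_union_le _ _)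
    by_cases hx0 : w x = 0
    · exact Or.inr hx0
    · obtain ⟨n, hn⟩ := (hu.eventually_lt_const (pos_iff_ne_zero.2 hx0)).exists
      exact Or.inl (mem_iUnion.2 ⟨n, hx, hn⟩)
  obtain ⟨n, hn⟩ := lt_iSup_iff.1 (hr.trans_le hmono)
  set B := A ∩ {x | u n < w x}
  have hB : MeasurableSet B := hA.1.inter (measurableSet_lt measurable_const hw)
  have hmB : m B ≠ ∞ := by
    refine ((measure_mono fun x hx => (hx.2 : u n < w x).le).trans
      (meas_ge_le_lintegral_div hw.aemeasurable (hu0 n).1.ne' ((hu0 n).2.trans_le le_top).ne)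
      |>.trans_lt (ENNReal.div_lt_top hwint (hu0 n).1.ne')).ne
  obtain ⟨δ, hδ, hδ'⟩ := exists_pos_setLIntegral_lt_of_measure_lt hwint
    (tsub_pos_of_lt hn).ne'
  obtain ⟨K, hKB, hK, hKδ⟩ := hB.exists_isCompact_sdiff_lt hmB hδ.ne'
  refine ⟨K, hKB.trans inter_subset_left, hK, ?_⟩
  by_contra! hle
  have h1 := hδ' _ hKδ
  rw [← withDensity_apply _ (hB.diff hK.measurableSet)] at h1
  rw [measure_sdiff hKB hK.measurableSet.nullMeasurableSet (measure_ne_top _ _)] at h1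
  exact absurd h1 (not_lt.2 (tsub_le_tsub_left hle _))

lemma MeasureTheory.Integrable.mul_of_integrable_withDensity {m : Measure X}
    {p : X → ℂ} (hp : Integrable p m) {g : X → ℂ}
    (hg : Integrable g (m.withDensity fun x => ‖p x‖ₑ)) : Integrable (fun x => g x * p x) m := by
  rw [integrable_withDensity_iff_integrable_smul₀' hp.aestronglyMeasurable.enorm
    (by simp)] at hg
  have h1 : Integrable (fun x => (‖p x‖ₑ.toReal • g x) * (p x / ‖p x‖)) m := by
    refine hg.mul_bdd (c := 1) ?_ ?_
    · have := hp.aestronglyMeasurable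
      exact (this.aemeasurable.div
        (Complex.measurable_ofReal.comp_aemeasurable this.norm.aemeasurable)).aestronglyMeasurable
    · refine Eventually.of_forall fun x => ?_
      simp [div_self_le_one]
  refine h1.congr (Eventually.of_forall fun x => ?_)
  by_cases hx : p x = 0
  · simp [hx]
  · have : (‖p x‖ : ℂ) ≠ 0 := by simpa using hx
    simp only [toReal_enorm, Complex.real_smul]
    field_simp

/-- The integral of `g` against the complex measure `p • m` is `∫ g p dm`. -/
lemma vectorMeasure_integral_withDensityᵥ {m : Measure X} {p : X → ℂ} (hp : Integrable p m)
    {g : X → ℂ} (hg : Integrable g (m.withDensity fun x => ‖p x‖ₑ)) :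
    VectorMeasure.integral (m.withDensityᵥ p) g (ContinuousLinearMap.mul ℝ ℂ) =
      ∫ x, g x * p x ∂m := by
  have hvar := Measure.variation_withDensityᵥ hp
  have hfin := isFiniteMeasure_withDensity_enorm hp
  have hfin' : IsFiniteMeasure (m.withDensityᵥ p).variation := by rwa [hvar]
  rw [← hvar] at hg
  refine Integrable.induction (P := fun g : X → ℂ =>
    VectorMeasure.integral (m.withDensityᵥ p) g (ContinuousLinearMap.mul ℝ ℂ) =
      ∫ x, g x * p x ∂m) ?_ ?_ ?_ ?_ hg
  · intro c s hs _
    rw [VectorMeasure.integral_indicator hs, VectorMeasure.setIntegral_const,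
      withDensityᵥ_apply hp hs, ContinuousLinearMap.mul_apply', ← integral_const_mul,
      ← integral_indicator hs]
    refine integral_congr_ae (Eventually.of_forall fun x => ?_)
    by_cases hx : x ∈ s <;> simp [hx]
  · intro f g _ hf hg ihf ihg
    rw [VectorMeasure.integral_add hf hg, ihf, ihg, ← integral_add]
    · simp [add_mul]
    · exact hp.mul_of_integrable_withDensity (hvar ▸ hf)
    · exact hp.mul_of_integrable_withDensity (hvar ▸ hg)
  · refine isClosed_eq VectorMeasure.continuous_integral ?_
    refine LipschitzWith.continuous (K := 1) (LipschitzWith.of_dist_le_mul fun f g => ?_)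
    have hf := hp.mul_of_integrable_withDensity (by rw [← hvar]; exact L1.integrable_coeFn f)
    have hg := hp.mul_of_integrable_withDensity (by rw [← hvar]; exact L1.integrable_coeFn g)
    have hsub : (fun x => ‖(f - g) x‖) =ᵐ[m.withDensity fun x => ‖p x‖ₑ] fun x => ‖f x - g x‖ := by
      rw [← hvar]
      exact (Lp.coeFn_sub f g).fun_comp norm
    rw [dist_eq_norm, ← integral_sub hf hg, NNReal.coe_one, one_mul, dist_eq_norm,
      L1.norm_eq_integral_norm]
    simp only [hvar]
    rw [integral_congr_ae hsub, integral_withDensity_eq_integral_toReal_smul₀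
      hp.aestronglyMeasurable.enorm (by simp)]
    refine (norm_integral_le_integral_norm _).trans_eq
      (integral_congr_ae (Eventually.of_forall fun x => ?_))
    beta_reduce
    rw [← sub_mul, norm_mul, mul_comm, toReal_enorm, smul_eq_mul]
  · intro f g hfg hf ih
    rw [← VectorMeasure.integral_congr_ae hfg, ih]
    rw [hvar, EventuallyEq, ae_withDensity_enorm_iff hp] at hfg
    refine integral_congr_ae (hfg.mono fun x hx => ?_)
    by_cases h0 : p x = 0
    · simp [h0]
    · simp [hx h0]

/-- A complex measure has finite total variation. -/
instance isFiniteMeasure_variation (c : ComplexMeasure X) : IsFiniteMeasure c.variation := by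
  refine isFiniteMeasure_of_le
    ((ComplexMeasure.re c).totalVariation + (ComplexMeasure.im c).totalVariation) ?_
  refine VectorMeasure.variation_le_of_forall_enorm_le fun E hE => ?_
  rw [SignedMeasure.totalVariation_eq_variation, SignedMeasure.totalVariation_eq_variation]
  have h : c E =
      ((ComplexMeasure.re c E : ℝ) : ℂ) + ((ComplexMeasure.im c E : ℝ) : ℂ) * Complex.I :=
    (Complex.re_add_im _).symm
  calc ‖c E‖ₑ ≤ ‖((ComplexMeasure.re c E : ℝ) : ℂ)‖ₑ
        + ‖((ComplexMeasure.im c E : ℝ) : ℂ) * Complex.I‖ₑ := h ▸ enorm_add_le _ _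
    _ = ‖ComplexMeasure.re c E‖ₑ + ‖ComplexMeasure.im c E‖ₑ := by
      simp [← ofReal_norm]
    _ ≤ _ := add_le_add (VectorMeasure.enorm_measure_le_variation _ _)
      (VectorMeasure.enorm_measure_le_variation _ _)

/-- The Radon-Nikodym theorem for complex measures. -/
lemma exists_integrable_withDensityᵥ_eq (c : ComplexMeasure X) (m : Measure X) [SigmaFinite m]
    (h : c.variation ≪ m) : ∃ p : X → ℂ, Integrable p m ∧ m.withDensityᵥ p = c := by
  have key : ∀ s, MeasurableSet s → m s = 0 → c s = 0 := fun s hs h0 => by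
    have := VectorMeasure.enorm_measure_le_variation c s
    rwa [h h0, nonpos_iff_eq_zero, enorm_eq_zero] at this
  have hre : m.withDensityᵥ ((ComplexMeasure.re c).rnDeriv m) = ComplexMeasure.re c := by
    refine SignedMeasure.withDensityᵥ_rnDeriv_eq _ _ (VectorMeasure.AbsolutelyContinuous.mk ?_)
    intro s hs h0
    rw [Measure.toENNRealVectorMeasure_apply_measurable hs] at h0
    exact congrArg Complex.re (key s hs h0)
  have him : m.withDensityᵥ ((ComplexMeasure.im c).rnDeriv m) = ComplexMeasure.im c := by
    refine SignedMeasure.withDensityᵥ_rnDeriv_eq _ _ (VectorMeasure.AbsolutelyContinuous.mk ?_)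
    intro s hs h0
    rw [Measure.toENNRealVectorMeasure_apply_measurable hs] at h0
    exact congrArg Complex.im (key s hs h0)
  refine ⟨c.rnDeriv m, c.integrable_rnDeriv m, ?_⟩
  ext s hs : 1
  have hi := (c.integrable_rnDeriv m).integrableOn (s := s)
  rw [withDensityᵥ_apply (c.integrable_rnDeriv m) hs]
  apply Complex.ext
  · rw [← RCLike.re_eq_complex_re, ← integral_re hi]
    have := congrArg (fun v : SignedMeasure X => v s) hre
    simp only [withDensityᵥ_apply (SignedMeasure.integrable_rnDeriv _ _) hs] at this
    exact this
  · rw [← RCLike.im_eq_complex_im, ← integral_im hi]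
    have := congrArg (fun v : SignedMeasure X => v s) him
    simp only [withDensityᵥ_apply (SignedMeasure.integrable_rnDeriv _ _) hs] at this
    exact this

end Densities

/-! ### Regular complex measures -/

section RegularMeasures

variable {X : Type*} [TopologicalSpace X] [T2Space X] [MeasurableSpace X] [BorelSpace X]

/-- A finite measure that is inner regular is carried by a countable union of compact sets. -/
lemma exists_isCompact_iUnion_measure_compl_eq_zero (m : Measure X) [m.Regular]
    [IsFiniteMeasure m] :
    ∃ K : ℕ → Set X, (∀ n, IsCompact (K n)) ∧ m (⋃ n, K n)ᶜ = 0 := by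
  have h (n : ℕ) := MeasurableSet.univ.exists_isCompact_sdiff_lt (measure_ne_top m univ)
    (ε := (n + 1 : ℝ≥0∞)⁻¹) (by simp)
  choose K _ hK hKm using h
  have hlim : Tendsto (fun n : ℕ => ((n + 1 : ℕ) : ℝ≥0∞)⁻¹) atTop (𝓝 0) :=
    ENNReal.tendsto_inv_nat_nhds_zero.comp (tendsto_add_atTop_nat 1)
  refine ⟨K, hK, le_antisymm (ge_of_tendsto' hlim fun n => ?_) zero_le⟩
  · refine (measure_mono ?_).trans ((hKm n).le.trans_eq (by simp))
    rw [← compl_eq_univ_sdiff]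
    exact compl_subset_compl.2 (subset_iUnion K n)

/-- The domain of the integrand need not be second countable: it suffices that the measure is
carried by a countable union of compact sets. -/
lemma Continuous.aestronglyMeasurable_of_regular {E : Type*} [TopologicalSpace E]
    [TopologicalSpace.PseudoMetrizableSpace E] {u : X → E} (hu : Continuous u) (m : Measure X)
    [m.Regular] [IsFiniteMeasure m] : AEStronglyMeasurable u m := by
  obtain ⟨K, hK, hKm⟩ := exists_isCompact_iUnion_measure_compl_eq_zero m
  rw [← Measure.restrict_eq_self_of_ae_mem (s := ⋃ n, K n) (μ := m) (mem_ae_iff.2 hKm),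
    aestronglyMeasurable_iUnion_iff]
  exact fun n => hu.continuousOn.aestronglyMeasurable_of_isCompact (hK n) (hK n).measurableSet

/-- Indicator functions can be approximated by functions in `C₀(X)` in the norm of `L¹(m)`. -/
lemma exists_C₀_integral_norm_indicator_sub_le [LocallyCompactSpace X] (m : Measure X) [m.Regular]
    [IsFiniteMeasure m] {s : Set X} (hs : MeasurableSet s) {ε : ℝ} (hε : 0 < ε) :
    ∃ g : C₀(X, ℂ), ∫ x, ‖s.indicator (fun _ => (1 : ℂ)) x - g x‖ ∂m ≤ ε := by
  have hε' : ENNReal.ofReal (ε / 2) ≠ 0 := by simpa using hε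
  obtain ⟨K, hKs, hK, hKε⟩ := hs.exists_isCompact_sdiff_lt (measure_ne_top m s) hε'
  obtain ⟨U, hKU, hU, -, hUε⟩ := hK.measurableSet.exists_isOpen_sdiff_lt (measure_ne_top m K) hε'
  obtain ⟨g, hgK, hgU, hgs, hg01⟩ := exists_continuous_one_zero_of_isCompact hK
    hU.isClosed_compl (disjoint_compl_right_iff_subset.2 hKU)
  let g' : C₀(X, ℂ) := ⟨⟨fun x => (g x : ℂ), by fun_prop⟩,
    (hgs.comp_left (g := ((↑) : ℝ → ℂ)) Complex.ofReal_zero).is_zero_at_infty⟩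
  have hsK := hs.diff hK.measurableSet
  have hUK := hU.measurableSet.diff hK.measurableSet
  -- The difference lives on `(s \ K) ∪ (U \ K)` and is bounded by `1`
  have hle (x : X) : ‖s.indicator (fun _ => (1 : ℂ)) x - g' x‖ ≤
      (s \ K).indicator (fun _ => (1 : ℝ)) x + (U \ K).indicator (fun _ => (1 : ℝ)) x := by
    change ‖s.indicator (fun _ => (1 : ℂ)) x - (g x : ℂ)‖ ≤ _
    obtain ⟨h0, h1⟩ := hg01 x
    by_cases hxK : x ∈ K
    · simp [hKs hxK, hgK hxK, hxK]
    · by_cases hxU : x ∈ U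
      · by_cases hxs : x ∈ s
        · rw [indicator_of_mem hxs, ← Complex.ofReal_one, ← Complex.ofReal_sub, Complex.norm_real,
            Real.norm_of_nonneg (by linarith)]
          simp [hxs, hxU, hxK]
          linarith
        · simpa [hxs, hxU, hxK, abs_of_nonneg h0] using h1
      · have : g x = 0 := hgU hxU
        by_cases hxs : x ∈ s <;> simp [hxs, hxU, hxK, this]
  refine ⟨g', ?_⟩
  have hi1 : Integrable ((s \ K).indicator fun _ => (1 : ℝ)) m := (integrable_const _).indicator hsK
  have hi2 : Integrable ((U \ K).indicator fun _ => (1 : ℝ)) m := (integrable_const _).indicator hUK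
  calc ∫ x, ‖s.indicator (fun _ => (1 : ℂ)) x - g' x‖ ∂m
      ≤ ∫ x, ((s \ K).indicator (fun _ => (1 : ℝ)) x + (U \ K).indicator (fun _ => (1 : ℝ)) x) ∂m :=
        integral_mono_of_nonneg (Eventually.of_forall fun _ => norm_nonneg _) (hi1.add hi2)
          (Eventually.of_forall hle)
    _ = m.real (s \ K) + m.real (U \ K) := by
        rw [integral_add hi1 hi2, integral_indicator_const _ hsK, integral_indicator_const _ hUK]
        simp
    _ ≤ ε / 2 + ε / 2 := add_le_add
        (ENNReal.toReal_le_of_le_ofReal (by positivity) hKε.le)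
        (ENNReal.toReal_le_of_le_ofReal (by positivity) hUε.le)
    _ = ε := add_halves ε

end RegularMeasures

namespace RegularComplexMeasure

section Basic

variable {X : Type*} [TopologicalSpace X] [MeasurableSpace X]

@[ext]
lemma ext {μ ν : RegularComplexMeasure X} (h : μ.toComplexMeasure = ν.toComplexMeasure) :
    μ = ν := by
  cases μ; cases ν; congr

instance (μ : RegularComplexMeasure X) : μ.tv.Regular := μ.regular

lemma integral_congr_ae (μ : RegularComplexMeasure X) {g g' : X → ℂ} (h : g =ᵐ[μ.tv] g') :
    μ.integral g = μ.integral g' :=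
  VectorMeasure.integral_congr_ae h

lemma integrable_C₀ [BorelSpace X] (μ : RegularComplexMeasure X) (g : C₀(X, ℂ)) :
    Integrable g μ.tv :=
  Integrable.of_bound g.continuous.aestronglyMeasurable ‖g.toBCF‖
    (Eventually.of_forall fun x => g.toBCF.norm_coe_le_norm x)

end Basic

variable {X : Type*} [TopologicalSpace X] [T2Space X] [LocallyCompactSpace X]
  [MeasurableSpace X] [BorelSpace X]

/-- The complex measure `p • m` for a regular measure `m` and `p ∈ L¹(m)`. -/
def ofDensity (m : Measure X) [m.Regular] (p : X → ℂ) (hp : Integrable p m) :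
    RegularComplexMeasure X where
  toComplexMeasure := m.withDensityᵥ p
  regular := by
    rw [Measure.variation_withDensityᵥ hp]
    exact regular_withDensity_enorm hp

variable {m : Measure X} [m.Regular] {p : X → ℂ}

lemma tv_ofDensity (hp : Integrable p m) :
    (ofDensity m p hp).tv = m.withDensity fun x => ‖p x‖ₑ :=
  Measure.variation_withDensityᵥ hp

lemma tv_ofDensity_absolutelyContinuous (hp : Integrable p m) : (ofDensity m p hp).tv ≪ m := by
  rw [tv_ofDensity]
  exact withDensity_absolutelyContinuous _ _

lemma ae_tv_ofDensity_iff (hp : Integrable p m) {P : X → Prop} :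
    (∀ᵐ x ∂(ofDensity m p hp).tv, P x) ↔ ∀ᵐ x ∂m, p x ≠ 0 → P x := by
  rw [tv_ofDensity, ae_withDensity_enorm_iff hp]

lemma ofDensity_congr {q : X → ℂ} (hp : Integrable p m) (hq : Integrable q m) (h : p =ᵐ[m] q) :
    ofDensity m p hp = ofDensity m q hq :=
  ext (WithDensityᵥEq.congr_ae h)

/-- A measure `p • m` is absolutely continuous with respect to `q • m` if `p` vanishes where `q`
does. -/
lemma tv_ofDensity_absolutelyContinuous_tv {q : X → ℂ} (hp : Integrable p m)
    (hq : Integrable q m) (h : ∀ᵐ x ∂m, q x = 0 → p x = 0) :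
    (ofDensity m p hp).tv ≪ (ofDensity m q hq).tv := by
  refine Measure.AbsolutelyContinuous.mk fun s _ hs => ?_
  have hs' : ∀ᵐ x ∂(ofDensity m q hq).tv, x ∉ s := by simpa [ae_iff] using hs
  have : ∀ᵐ x ∂(ofDensity m p hp).tv, x ∉ s := by
    rw [ae_tv_ofDensity_iff] at hs' ⊢
    filter_upwards [hs', h] with x h1 h2 h3 using h1 fun h4 => h3 (h2 h4)
  simpa [ae_iff] using this

lemma integrable_mul_of_integrable_tv (hp : Integrable p m) {g : X → ℂ}
    (hg : Integrable g (ofDensity m p hp).tv) : Integrable (fun x => g x * p x) m :=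
  hp.mul_of_integrable_withDensity (by rwa [← tv_ofDensity hp])

lemma integral_ofDensity (hp : Integrable p m) {g : X → ℂ}
    (hg : Integrable g (ofDensity m p hp).tv) :
    (ofDensity m p hp).integral g = ∫ x, g x * p x ∂m :=
  vectorMeasure_integral_withDensityᵥ hp (by rwa [← tv_ofDensity hp])

/-- Radon-Nikodym with respect to a regular measure `m`, which need not be `σ`-finite: `|μ|` is
carried by a `σ`-compact set, and `m` is `σ`-finite there. -/
lemma exists_eq_ofDensity (μ : RegularComplexMeasure X) (m : Measure X) [m.Regular]
    (h : μ.tv ≪ m) : ∃ (p : X → ℂ) (hp : Integrable p m), μ = ofDensity m p hp := by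
  obtain ⟨K, hK, hKm⟩ := exists_isCompact_iUnion_measure_compl_eq_zero μ.tv
  set S := ⋃ n, K n
  have hS : MeasurableSet S := .iUnion fun n => (hK n).measurableSet
  have : SigmaFinite (m.restrict S) := by
    have hA (n : ℕ) : IsCompact (accumulate K n) := isCompact_accumulate hK n
    refine ⟨⟨⟨fun n => accumulate K n ∪ Sᶜ, fun _ => trivial, fun n => ?_, ?_⟩⟩⟩
    · rw [Measure.restrict_apply ((hA n).measurableSet.union hS.compl), union_inter_distrib_right,
        compl_inter_self, union_empty]
      exact (measure_mono inter_subset_left).trans_lt (hA n).measure_lt_top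
    · rw [← iUnion_union, iUnion_accumulate, union_compl_self]
  have hac : μ.tv ≪ m.restrict S := by
    rw [← Measure.restrict_eq_self_of_ae_mem (s := S) (μ := μ.tv) (mem_ae_iff.2 hKm)]
    exact h.restrict S
  obtain ⟨p, hp, hpμ⟩ := exists_integrable_withDensityᵥ_eq μ.toComplexMeasure (m.restrict S) hac
  -- `p` is only meaningful on `S`; extended by zero it is integrable for the whole of `m`.
  have hp' : Integrable (S.indicator p) m := (integrable_indicator_iff hS).2 hp
  refine ⟨S.indicator p, hp', ext ?_⟩
  rw [← hpμ]
  ext s hs : 1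
  rw [withDensityᵥ_apply hp hs]
  refine Eq.trans ?_ (withDensityᵥ_apply hp' hs).symm
  rw [setIntegral_indicator hS, Measure.restrict_restrict hs]

/-- The map from `M(X)` to the dual of `C₀(X)` is injective. -/
lemma eq_of_forall_integral_eq {μ ν : RegularComplexMeasure X}
    (h : ∀ g : C₀(X, ℂ), μ.integral g = ν.integral g) : μ = ν := by
  refine ext (VectorMeasure.ext fun s hs => ?_)
  have hind (ρ : RegularComplexMeasure X) :
      ρ.toComplexMeasure s = ρ.integral (s.indicator fun _ => 1) := by
    rw [integral, VectorMeasure.integral_indicator hs, VectorMeasure.setIntegral_const]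
    simp
  rw [hind, hind, ← sub_eq_zero, ← norm_eq_zero]
  refine le_antisymm (le_of_forall_pos_le_add fun ε hε => ?_) (norm_nonneg _)
  obtain ⟨g, hg⟩ := exists_C₀_integral_norm_indicator_sub_le (μ.tv + ν.tv) hs hε
  have hint (ρ : RegularComplexMeasure X) : Integrable (s.indicator fun _ => (1 : ℂ)) ρ.tv :=
    (integrable_const _).indicator hs
  have hdiff (ρ : RegularComplexMeasure X) :
      Integrable (fun x => ‖s.indicator (fun _ => (1 : ℂ)) x - g x‖) ρ.tv :=
    ((hint ρ).sub (ρ.integrable_C₀ g)).norm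
  rw [integral_add_measure (hdiff μ) (hdiff ν)] at hg
  have key (ρ : RegularComplexMeasure X) :
      ‖ρ.integral (s.indicator fun _ => 1) - ρ.integral g‖ ≤
        ∫ x, ‖s.indicator (fun _ => (1 : ℂ)) x - g x‖ ∂ρ.tv := by
    rw [integral, integral, ← VectorMeasure.integral_sub (hint ρ) (ρ.integrable_C₀ g)]
    refine VectorMeasure.norm_integral_le_integral_norm.trans ?_
    refine mul_le_of_le_one_left (integral_nonneg fun _ => norm_nonneg _) ?_
    exact ContinuousLinearMap.opNorm_mul_le ℝ ℂ
  calc _ = ‖(μ.integral (s.indicator fun _ => 1) - μ.integral g) -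
        (ν.integral (s.indicator fun _ => 1) - ν.integral g)‖ := by rw [h g]; congr 1; ring
    _ ≤ _ := (norm_sub_le _ _).trans
      ((add_le_add (key μ) (key ν)).trans (hg.trans_eq (zero_add ε).symm))

lemma IsConvolution.unique [Mul X] {μ ν ρ ρ' : RegularComplexMeasure X}
    (h : IsConvolution μ ν ρ) (h' : IsConvolution μ ν ρ') : ρ = ρ' :=
  eq_of_forall_integral_eq fun g => (h g).trans (h' g).symm

end RegularComplexMeasure

/-! ### Generalised functions -/

namespace GeneralisedFunction

open RegularComplexMeasure

section Basic

variable {X : Type*} [TopologicalSpace X] [MeasurableSpace X]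

lemma integrable_toFun (f : GeneralisedFunction X) {μ ν : RegularComplexMeasure X}
    (h : μ.tv ≪ ν.tv) : Integrable (f.toFun ν) μ.tv := by
  have : MemLp (f.toFun μ) 1 μ.tv := (Lp.memLp (f.toFun μ)).mono_exponent le_top
  exact (memLp_one_iff_integrable.1 this).congr (f.compatible μ ν h)

lemma pairing_ofC₀ [BorelSpace X] (h : C₀(X, ℂ)) (μ : RegularComplexMeasure X) :
    (ofC₀ h).pairing μ = μ.integral h :=
  integral_congr_ae _ (memLp_top_C₀ h μ.tv).coeFn_toLp

lemma ofC₀_mem_vanishingAtInfinity [BorelSpace X] (h : C₀(X, ℂ)) :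
    ofC₀ h ∈ vanishingAtInfinity X := by
  intro ε hε
  have h0 := (ZeroAtInftyContinuousMapClass.zero_at_infty h).norm
  rw [norm_zero] at h0
  obtain ⟨K, hK, hKε⟩ := mem_cocompact.1 (h0.eventually_lt_const hε)
  refine ⟨K, hK, fun μ => ?_⟩
  filter_upwards [(memLp_top_C₀ h μ.tv).coeFn_toLp] with x hx hxK
  change ‖((memLp_top_C₀ h μ.tv).toLp h) x‖ < ε
  rw [hx]
  exact hKε hxK

end Basic

variable {X : Type*} [TopologicalSpace X] [T2Space X] [LocallyCompactSpace X]
  [MeasurableSpace X] [BorelSpace X]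

/-- `⟨f, p • m⟩` can be computed from any coordinate `f_ν` with `|p • m| ≪ |ν|`. -/
lemma pairing_ofDensity (f : GeneralisedFunction X) {m : Measure X} [m.Regular] {p : X → ℂ}
    (hp : Integrable p m) {ν : RegularComplexMeasure X} (h : (ofDensity m p hp).tv ≪ ν.tv) :
    f.pairing (ofDensity m p hp) = ∫ x, f.toFun ν x * p x ∂m := by
  rw [pairing, integral_congr_ae _ (f.compatible _ ν h),
    integral_ofDensity hp (f.integrable_toFun h)]

/-- `M(X)` separates generalised functions: test against the restrictions of `|μ|` to measurable
sets. -/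
lemma eq_of_forall_pairing_eq {f g : GeneralisedFunction X}
    (h : ∀ μ : RegularComplexMeasure X, f.pairing μ = g.pairing μ) : f = g := by
  refine GeneralisedFunction.ext (funext fun μ => Lp.ext ?_)
  have hi (f : GeneralisedFunction X) : Integrable (f.toFun μ) μ.tv :=
    f.integrable_toFun Measure.AbsolutelyContinuous.rfl
  refine (hi f).ae_eq_of_forall_setIntegral_eq _ _ (hi g) fun s hs _ => ?_
  have hp : Integrable (s.indicator fun _ => (1 : ℂ)) μ.tv := (integrable_const _).indicator hs
  have hs' (f : GeneralisedFunction X) :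
      f.pairing (ofDensity μ.tv _ hp) = ∫ x in s, f.toFun μ x ∂μ.tv := by
    rw [f.pairing_ofDensity hp (tv_ofDensity_absolutelyContinuous hp), ← integral_indicator hs]
    refine MeasureTheory.integral_congr_ae (Eventually.of_forall fun x => ?_)
    by_cases hx : x ∈ s <;> simp [hx]
  rw [← hs', ← hs', h]

/-- The coordinates at the measures `p • m` of a generalised function vanishing at infinity are
uniformly bounded: outside a compact set `K` by `1`, and on `K` by the norm of the single
coordinate at the restriction of `m` to `K`. -/
lemma exists_bound {f : GeneralisedFunction X} (hf : f ∈ vanishingAtInfinity X) (m : Measure X)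
    [m.Regular] :
    ∃ C : ℝ, 0 ≤ C ∧ ∀ (p : X → ℂ) (hp : Integrable p m),
      ∀ᵐ x ∂m, p x ≠ 0 → ‖f.toFun (ofDensity m p hp) x‖ ≤ C := by
  obtain ⟨K, hK, hK1⟩ := hf 1 one_pos
  have hKm := hK.measurableSet
  have hq : Integrable (K.indicator fun _ => (1 : ℂ)) m :=
    (integrable_indicator_iff hKm).2 (integrableOn_const hK.measure_lt_top.ne)
  set ρ := ofDensity m _ hq with hρ
  refine ⟨max 1 ‖f.toFun ρ‖, by positivity, fun p hp => ?_⟩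
  have hpK : Integrable (K.indicator p) m := hp.indicator hKm
  have hbd : ∀ᵐ x ∂ρ.tv, ‖f.toFun ρ x‖ ≤ ‖f.toFun ρ‖ := by
    have := ae_le_eLpNormEssSup (f := f.toFun ρ) (μ := ρ.tv)
    filter_upwards [this] with x hx
    rw [← eLpNorm_exponent_top] at hx
    rw [Lp.norm_def]
    simpa using ENNReal.toReal_mono (Lp.eLpNorm_ne_top _) hx
  have h1 := f.compatible (ofDensity m _ hpK) (ofDensity m p hp)
    (tv_ofDensity_absolutelyContinuous_tv hpK hp
      (Eventually.of_forall fun x hx => by simp [hx]))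
  have hac : (ofDensity m _ hpK).tv ≪ ρ.tv := tv_ofDensity_absolutelyContinuous_tv hpK hq
      (Eventually.of_forall fun x hx => by
        have : x ∉ K := fun h => by simp [h] at hx
        simp [this])
  have h2 := f.compatible (ofDensity m _ hpK) ρ hac
  have h3 := hac.ae_le hbd
  have h4 := hK1 (ofDensity m p hp)
  rw [EventuallyEq, ae_tv_ofDensity_iff] at h1 h2
  have h3' := (ae_tv_ofDensity_iff hpK).1 h3
  rw [ae_tv_ofDensity_iff] at h4
  filter_upwards [h1, h2, h3', h4] with x h1 h2 h3 h4 hx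
  by_cases hxK : x ∈ K
  · have hx' : K.indicator p x ≠ 0 := by simpa [hxK] using hx
    rw [← h1 hx', h2 hx']
    exact (h3 hx').trans (le_max_right _ _)
  · exact (h4 hx hxK).le.trans (le_max_left _ _)

end GeneralisedFunction

/-! ### Cohen's factorization theorem -/

section Cohen

variable {A E : Type*} [NormedAddCommGroup A] [NormedSpace ℂ A]
  [NormedAddCommGroup E] [NormedSpace ℂ E] [CompleteSpace E]

/-- The inductive step in the factorization theorem of Cohen: an invertible operator
`t + π a` is replaced by an invertible operator `3t/4 + π a'` so that the value of its inverse at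
`x` hardly changes. -/
lemma exists_cohen_step [Nontrivial E] (π : A →L[ℂ] E →L[ℂ] E) (hπ : ∀ a, ‖π a‖ ≤ ‖a‖)
    (hπ1 : ∀ (a : A) (x : E) (ε : ℝ), 0 < ε →
      ∃ e : A, ‖e‖ ≤ 1 ∧ ‖π e * π a - π a‖ ≤ ε ∧ ‖π e x - x‖ ≤ ε)
    (x : E) {t : ℝ} (ht : 0 < t) {a : A} {u : (E →L[ℂ] E)ˣ}
    (hu : (u : E →L[ℂ] E) = (t : ℂ) • 1 + π a)
    {δ : ℝ} (hδ : 0 < δ) :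
    ∃ (a' : A) (u' : (E →L[ℂ] E)ˣ), (u' : E →L[ℂ] E) = ((3 / 4 * t : ℝ) : ℂ) • 1 + π a' ∧
      ‖a' - a‖ ≤ t / 4 ∧ ‖(↑u'⁻¹ : E →L[ℂ] E) x - (↑u⁻¹ : E →L[ℂ] E) x‖ ≤ δ := by
  have hcont : ContinuousAt (fun q : (E →L[ℂ] E) × E => Ring.inverse q.1 q.2) (↑u, x) :=
    ((NormedRing.inverse_continuousAt u).comp_of_eq continuousAt_fst rfl).clm_apply continuousAt_snd
  obtain ⟨η, hη, hηδ⟩ := Metric.continuousAt_iff.1 hcont δ hδ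
  obtain ⟨θ, hθ, hθ1, hθ2⟩ : ∃ θ : ℝ, 0 < θ ∧ θ < η ∧ θ < ‖(↑u⁻¹ : E →L[ℂ] E)‖⁻¹ := by
    obtain ⟨θ, hθ, hθ'⟩ := exists_between (lt_min hη (inv_pos.2 (Units.norm_pos u⁻¹)))
    exact ⟨θ, hθ, hθ'.trans_le (min_le_left _ _), hθ'.trans_le (min_le_right _ _)⟩
  obtain ⟨e, he, hea, hex⟩ := hπ1 a x θ hθ
  have hπe : ‖π e‖ ≤ 1 := (hπ e).trans he
  -- The operator `3/4 + (1/4) π e` is invertible, and its inverse has norm at most `2`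
  obtain ⟨y, hy⟩ : ∃ y : (E →L[ℂ] E)ˣ, (y : E →L[ℂ] E) = (3 / 4 : ℂ) • 1 + (1 / 4 : ℂ) • π e := by
    have h3 : ‖-((1 / 3 : ℂ) • π e)‖ < 1 := by
      rw [norm_neg, norm_smul]
      norm_num
      linarith
    refine ⟨Units.mk0 (3 / 4 : ℂ) (by norm_num) • Units.oneSub _ h3, ?_⟩
    rw [Units.val_smul, Units.val_oneSub, Units.smul_def, Units.val_mk0, sub_neg_eq_add, smul_add,
      smul_smul]
    norm_num
  have hy2 (w : E) : ‖(↑y⁻¹ : E →L[ℂ] E) w‖ ≤ 2 * ‖w‖ := by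
    set v := (↑y⁻¹ : E →L[ℂ] E) w with hv
    have hw : w = (3 / 4 : ℂ) • v + (1 / 4 : ℂ) • π e v := by
      have : (↑y * ↑y⁻¹ : E →L[ℂ] E) w = w := by rw [Units.mul_inv]; rfl
      rw [hy] at this
      exact this.symm
    have h1 : ‖(3 / 4 : ℂ) • v‖ ≤ ‖w‖ + ‖(1 / 4 : ℂ) • π e v‖ := by
      rw [show (3 / 4 : ℂ) • v = w - (1 / 4 : ℂ) • π e v by rw [eq_sub_iff_add_eq]; exact hw.symm]
      exact norm_sub_le _ _
    have h2 : ‖π e v‖ ≤ ‖v‖ := ((π e).le_of_opNorm_le hπe v).trans_eq (one_mul _)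
    rw [norm_smul, norm_smul] at h1
    norm_num at h1
    linarith
  -- `3t/4 + π a'` factors as `y W`, where `W = t + y⁻¹ π a` is close to `u = t + π a`, since
  -- `π e π a` is close to `π a`.
  set W : E →L[ℂ] E := (t : ℂ) • 1 + ↑y⁻¹ * π a with hW
  have hWu : ‖W - u‖ ≤ θ := by
    have h1 : W - u = ↑y⁻¹ * ((1 / 4 : ℂ) • (π a - π e * π a)) := by
      have h2 : (1 / 4 : ℂ) • (π a - π e * π a) = π a - ↑y * π a := by
        rw [hy, add_mul, smul_mul_assoc, one_mul, smul_mul_assoc]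
        module
      rw [h2, mul_sub, ← mul_assoc, Units.inv_mul, one_mul, hW, hu]
      abel
    rw [h1]
    refine ContinuousLinearMap.opNorm_le_bound _ hθ.le fun v => (hy2 _).trans ?_
    have h3 : ‖(π a - π e * π a) v‖ ≤ θ * ‖v‖ :=
      ContinuousLinearMap.le_of_opNorm_le _ (by rwa [norm_sub_rev]) v
    have h4 : ((1 / 4 : ℂ) • (π a - π e * π a)) v = (1 / 4 : ℂ) • (π a - π e * π a) v := rfl
    have h5 : 0 ≤ θ * ‖v‖ := by positivity
    rw [ContinuousLinearMap.coe_coe, h4, norm_smul]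
    norm_num at h3 ⊢
    linarith
  let w : (E →L[ℂ] E)ˣ := u.ofNearby W (hWu.trans_lt hθ2)
  have hw : (w : E →L[ℂ] E) = W := rfl
  refine ⟨a + (t / 4 : ℂ) • e, y * w, ?_, ?_, ?_⟩
  · rw [Units.val_mul, hw, hW, mul_add, ← mul_assoc, Units.mul_inv, one_mul, mul_smul_comm, mul_one,
      hy, map_add, map_smul]
    push_cast
    module
  · rw [add_sub_cancel_left, norm_smul]
    have : ‖(t / 4 : ℂ)‖ = t / 4 := by
      rw [show (t / 4 : ℂ) = ((t / 4 : ℝ) : ℂ) by push_cast; rfl, Complex.norm_real,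
        Real.norm_of_nonneg (by positivity)]
    rw [this]
    exact mul_le_of_le_one_right (by positivity) he
  · have h1 : dist (W, (↑y⁻¹ : E →L[ℂ] E) x) (↑u, x) < η := by
      rw [Prod.dist_eq, max_lt_iff, dist_eq_norm, dist_eq_norm]
      refine ⟨hWu.trans_lt hθ1, lt_of_le_of_lt ?_ hθ1⟩
      have h2 : (↑y⁻¹ : E →L[ℂ] E) x - x = (↑y⁻¹ : E →L[ℂ] E) ((1 / 4 : ℂ) • (x - π e x)) := by
        have h3 : (1 / 4 : ℂ) • (x - π e x) = x - (y : E →L[ℂ] E) x := by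
          rw [hy]
          simp only [add_apply, smul_apply, one_apply_eq_self]
          module
        have h4 : (↑y⁻¹ * ↑y : E →L[ℂ] E) x = x := by rw [Units.inv_mul]; rfl
        rw [h3, map_sub]
        exact congrArg _ h4.symm
      rw [h2]
      refine (hy2 _).trans ?_
      rw [norm_smul, norm_sub_rev]
      norm_num
      linarith
    have h2 := (hηδ h1).le
    rw [dist_eq_norm] at h2
    simp only [Ring.inverse_unit] at h2
    rw [← hw, Ring.inverse_unit] at h2
    rw [mul_inv_rev, Units.val_mul]
    exact h2

/-- **Cohen's factorization theorem** for a Banach space `A` acting by operators on a Banach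
space `E`: if there are approximate units of norm at most one, then every element of `E` is of the
form `π a y`. Iterating `exists_cohen_step` gives operators `u n = (3/4)^n + π (a n)` for which
`a n` and `(u n)⁻¹ x` are Cauchy sequences, and their limits are `a` and `y`. -/
theorem exists_cohen_factorization [CompleteSpace A] (π : A →L[ℂ] E →L[ℂ] E) (hπ : ∀ a, ‖π a‖ ≤ ‖a‖)
    (hπ1 : ∀ (a : A) (x : E) (ε : ℝ), 0 < ε →
      ∃ e : A, ‖e‖ ≤ 1 ∧ ‖π e * π a - π a‖ ≤ ε ∧ ‖π e x - x‖ ≤ ε)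
    (x : E) : ∃ (a : A) (y : E), π a y = x := by
  rcases subsingleton_or_nontrivial E with hE | hE
  · exact ⟨0, 0, Subsingleton.elim _ _⟩
  let P (n : ℕ) (s : A × (E →L[ℂ] E)ˣ) : Prop :=
    (s.2 : E →L[ℂ] E) = (((3 / 4) ^ n : ℝ) : ℂ) • 1 + π s.1
  have hstep (n : ℕ) (s : A × (E →L[ℂ] E)ˣ) : P n s → ∃ s' : A × (E →L[ℂ] E)ˣ, P (n + 1) s' ∧
      ‖s'.1 - s.1‖ ≤ 1 / 4 * (3 / 4) ^ n ∧
      ‖(↑s'.2⁻¹ : E →L[ℂ] E) x - (↑s.2⁻¹ : E →L[ℂ] E) x‖ ≤ 1 * (1 / 2) ^ n := by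
    intro hs
    obtain ⟨a', u', h1, h2, h3⟩ := exists_cohen_step π hπ hπ1 x (t := (3 / 4) ^ n) (by positivity)
      hs (δ := 1 * (1 / 2) ^ n) (by positivity)
    refine ⟨(a', u'), ?_, h2.trans_eq (by ring), h3⟩
    rw [← pow_succ'] at h1
    exact h1
  choose! F hF1 hF2 hF3 using hstep
  let s (n : ℕ) : A × (E →L[ℂ] E)ˣ := Nat.rec (0, 1) F n
  have hs (n : ℕ) : P n (s n) := by
    induction n with
    | zero => simp [P, s]
    | succ n ih => exact hF1 n _ ih
  have hca : CauchySeq fun n => (s n).1 :=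
    cauchySeq_of_le_geometric (3 / 4) (1 / 4) (by norm_num) fun n => by
      rw [dist_comm, dist_eq_norm]
      exact hF2 n _ (hs n)
  have hcy : CauchySeq fun n => (↑(s n).2⁻¹ : E →L[ℂ] E) x :=
    cauchySeq_of_le_geometric (1 / 2) 1 (by norm_num) fun n => by
      rw [dist_comm, dist_eq_norm]
      exact hF3 n _ (hs n)
  obtain ⟨a, ha⟩ := cauchySeq_tendsto_of_complete hca
  obtain ⟨y, hy⟩ := cauchySeq_tendsto_of_complete hcy
  refine ⟨a, y, ?_⟩
  have hlim : Tendsto (fun n => (((3 / 4) ^ n : ℝ) : ℂ) • (↑(s n).2⁻¹ : E →L[ℂ] E) x +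
      π (s n).1 ((↑(s n).2⁻¹ : E →L[ℂ] E) x)) atTop (𝓝 (((0 : ℝ) : ℂ) • y + π a y)) := by
    refine Tendsto.add (Tendsto.smul ?_ hy) ?_
    · exact (Complex.continuous_ofReal.tendsto 0).comp
        (tendsto_pow_atTop_nhds_zero_of_lt_one (by norm_num) (by norm_num))
    · exact ((continuous_fst.clm_apply continuous_snd).tendsto (π a, y)).comp
        (((π.continuous.tendsto a).comp ha).prodMk_nhds hy)
  have hconst (n : ℕ) : (((3 / 4) ^ n : ℝ) : ℂ) • (↑(s n).2⁻¹ : E →L[ℂ] E) x +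
      π (s n).1 ((↑(s n).2⁻¹ : E →L[ℂ] E) x) = x := by
    have h1 : (↑(s n).2 * ↑(s n).2⁻¹ : E →L[ℂ] E) x = x := by rw [Units.mul_inv]; rfl
    have h2 : ((s n).2 : E →L[ℂ] E) = _ := hs n
    rw [h2] at h1
    exact h1
  simp only [hconst] at hlim
  have := tendsto_nhds_unique hlim tendsto_const_nhds
  simpa using this

end Cohen

/-! ### Translations on `C₀(G)` and `L¹(G)` -/

namespace ZeroAtInftyContinuousMap

section General

variable {X : Type*} [TopologicalSpace X]

lemma norm_apply_le (h : C₀(X, ℂ)) (x : X) : ‖h x‖ ≤ ‖h‖ :=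
  h.toBCF.norm_coe_le_norm x

lemma norm_le_of_forall {h : C₀(X, ℂ)} {C : ℝ} (hC : 0 ≤ C) (hh : ∀ x, ‖h x‖ ≤ C) : ‖h‖ ≤ C :=
  (BoundedContinuousFunction.norm_le (f := h.toBCF) hC).2 hh

/-- Evaluation at a point, as a continuous linear functional on `C₀(X)`. -/
def evalCLM (x : X) : C₀(X, ℂ) →L[ℂ] ℂ :=
  LinearMap.mkContinuous
    { toFun := fun h => h x
      map_add' := fun _ _ => rfl
      map_smul' := fun _ _ => rfl } 1
    fun h => by simpa using! norm_apply_le h x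

@[simp]
lemma evalCLM_apply (x : X) (h : C₀(X, ℂ)) : evalCLM x h = h x := rfl

end General

variable {G : Type*} [Group G] [TopologicalSpace G] [IsTopologicalGroup G]

/-- The left translate `y ↦ h (x y)`. -/
def leftTranslate (h : C₀(G, ℂ)) (x : G) : C₀(G, ℂ) :=
  h.comp (Homeomorph.mulLeft x).toCocompactMap

/-- The right translate `y ↦ h (y x)`. -/
def rightTranslate (h : C₀(G, ℂ)) (x : G) : C₀(G, ℂ) :=
  h.comp (Homeomorph.mulRight x).toCocompactMap

@[simp]
lemma rightTranslate_apply (h : C₀(G, ℂ)) (x y : G) : h.rightTranslate x y = h (y * x) := rfl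

lemma norm_leftTranslate_le (h : C₀(G, ℂ)) (x : G) : ‖h.leftTranslate x‖ ≤ ‖h‖ :=
  norm_le_of_forall (norm_nonneg _) fun _ => norm_apply_le h _

lemma norm_rightTranslate_le (h : C₀(G, ℂ)) (x : G) : ‖h.rightTranslate x‖ ≤ ‖h‖ :=
  norm_le_of_forall (norm_nonneg _) fun _ => norm_apply_le h _

/-- A function in `C₀(G)` is uniformly continuous for the right uniform structure of `G`. -/
lemma continuous_leftTranslate (h : C₀(G, ℂ)) : Continuous h.leftTranslate := by
  let _ := IsTopologicalGroup.rightUniformSpace G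
  refine continuous_iff_continuousAt.2 fun x₀ => Metric.continuousAt_iff'.2 fun ε hε => ?_
  have hu := (ZeroAtInftyContinuousMap.uniformContinuous h)
    (Metric.dist_mem_uniformity (half_pos hε))
  rw [mem_map, uniformity_eq_comap_nhds_one' G, mem_comap] at hu
  obtain ⟨V, hV, hVh⟩ := hu
  have hlim : Tendsto (fun x => x₀ * x⁻¹) (𝓝 x₀) (𝓝 1) :=
    Continuous.tendsto' (by fun_prop) _ _ (mul_inv_cancel x₀)
  filter_upwards [hlim hV] with x hx
  rw [dist_eq_norm]
  refine (norm_le_of_forall (half_pos hε).le fun y => ?_).trans_lt (half_lt_self hε)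
  have hxy : (x * y, x₀ * y) ∈ (fun p : G × G => p.2 * p.1⁻¹) ⁻¹' V := by
    simpa [mul_assoc] using hx
  have := hVh hxy
  rw [mem_preimage, mem_ofPred_eq, dist_eq_norm] at this
  exact this.le

/-- A function in `C₀(G)` is uniformly continuous for the left uniform structure of `G`. -/
lemma continuous_rightTranslate (h : C₀(G, ℂ)) : Continuous h.rightTranslate := by
  let _ := IsTopologicalGroup.leftUniformSpace G
  refine continuous_iff_continuousAt.2 fun x₀ => Metric.continuousAt_iff'.2 fun ε hε => ?_
  have hu := (ZeroAtInftyContinuousMap.uniformContinuous h)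
    (Metric.dist_mem_uniformity (half_pos hε))
  rw [mem_map, uniformity_eq_comap_nhds_one_left G, mem_comap] at hu
  obtain ⟨V, hV, hVh⟩ := hu
  have hlim : Tendsto (fun x => x⁻¹ * x₀) (𝓝 x₀) (𝓝 1) :=
    Continuous.tendsto' (by fun_prop) _ _ (inv_mul_cancel x₀)
  filter_upwards [hlim hV] with x hx
  rw [dist_eq_norm]
  refine (norm_le_of_forall (half_pos hε).le fun y => ?_).trans_lt (half_lt_self hε)
  have hxy : (y * x, y * x₀) ∈ (fun p : G × G => p.1⁻¹ * p.2) ⁻¹' V := by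
    simpa [mul_assoc] using hx
  have := hVh hxy
  rw [mem_preimage, mem_ofPred_eq, dist_eq_norm] at this
  exact this.le

end ZeroAtInftyContinuousMap

section Translation

variable {G : Type*} [Group G] [TopologicalSpace G] [IsTopologicalGroup G]
  [MeasurableSpace G] [BorelSpace G] {ν : Measure G} [ν.IsMulLeftInvariant]

/-- The translate `x ↦ k (u⁻¹ x)` of `k ∈ L¹(ν)`, as a linear isometry of `L¹(ν)`. -/
def translateL1 (ν : Measure G) [ν.IsMulLeftInvariant] (u : G) :
    Lp ℂ 1 ν →ₗᵢ[ℂ] Lp ℂ 1 ν :=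
  Lp.compMeasurePreservingₗᵢ ℂ (fun x => u⁻¹ * x) (measurePreserving_mul_left ν u⁻¹)

lemma coeFn_translateL1 (u : G) (k : Lp ℂ 1 ν) :
    translateL1 ν u k =ᵐ[ν] fun x => k (u⁻¹ * x) :=
  Lp.coeFn_compMeasurePreserving k (measurePreserving_mul_left ν u⁻¹)

lemma continuous_translateL1 [LocallyCompactSpace G] [T2Space G] [ν.Regular] (k : Lp ℂ 1 ν) :
    Continuous fun u => translateL1 ν u k := by
  let F : C(G × G, G) := ⟨fun q => q.1⁻¹ * q.2, by fun_prop⟩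
  exact Continuous.compMeasurePreservingLp (g := fun u => F.curry u) continuous_const
    F.curry.continuous (fun u => measurePreserving_mul_left ν u⁻¹) ENNReal.one_ne_top

lemma translateL1_one (k : Lp ℂ 1 ν) : translateL1 ν 1 k = k := by
  refine Lp.ext ((coeFn_translateL1 1 k).trans (Eventually.of_forall fun x => ?_))
  simp

/-- Change of variables in an integral against a translate. -/
lemma integral_mul_translateL1 (g : G → ℂ) (u : G) (k : Lp ℂ 1 ν) :
    ∫ x, g x * translateL1 ν u k x ∂ν = ∫ x, g (u * x) * k x ∂ν := by
  rw [← integral_mul_left_eq_self _ u]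
  have := (measurePreserving_mul_left ν u).quasiMeasurePreserving.ae_eq (coeFn_translateL1 u k)
  refine integral_congr_ae (this.mono fun x hx => ?_)
  simp only [Function.comp_def, inv_mul_cancel_left] at hx
  simp [hx]

end Translation

/-! ### The action of `L¹(G)` on `C₀(G)` -/

/-- An integrable scalar function times a bounded continuous function with values in a Banach
space, which need not be separable, is integrable with respect to a regular measure. -/
lemma MeasureTheory.Integrable.smul_of_continuous_of_bound {X E : Type*} [TopologicalSpace X]
    [T2Space X] [LocallyCompactSpace X] [MeasurableSpace X] [BorelSpace X]
    [NormedAddCommGroup E] [NormedSpace ℂ E] {m : Measure X} [m.Regular] {p : X → ℂ}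
    (hp : Integrable p m) {u : X → E} (hu : Continuous u) {C : ℝ} (hC : ∀ x, ‖u x‖ ≤ C) :
    Integrable (fun x => p x • u x) m := by
  have := regular_withDensity_enorm hp
  have := isFiniteMeasure_withDensity_enorm hp
  obtain ⟨v, hv, huv⟩ := hu.aestronglyMeasurable_of_regular (m.withDensity fun x => ‖p x‖ₑ)
  rw [EventuallyEq, ae_withDensity_enorm_iff hp] at huv
  have hmeas : AEStronglyMeasurable (fun x => p x • u x) m := by
    refine (hp.aestronglyMeasurable.smul hv.aestronglyMeasurable).congr (huv.mono fun x hx => ?_)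
    by_cases h0 : p x = 0
    · simp [h0]
    · simp [hx h0]
  refine (hp.norm.mul_const C).mono' hmeas (Eventually.of_forall fun x => ?_)
  rw [norm_smul]
  exact mul_le_mul_of_nonneg_left (hC x) (norm_nonneg _)

/-- Averages of a function stay close to a vector to which the values of the function are
close. -/
lemma norm_integral_smul_sub_le {X E : Type*} [MeasurableSpace X] [NormedAddCommGroup E]
    [NormedSpace ℂ E] [CompleteSpace E] {m : Measure X} {e : Lp ℂ 1 m} (he : ∫ x, e x ∂m = 1)
    (he1 : ‖e‖ ≤ 1) {u : X → E} (hu : Integrable (fun x => e x • u x) m) {c : E} {ε : ℝ}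
    (hε : 0 ≤ ε) (h : ∀ᵐ x ∂m, e x ≠ 0 → ‖u x - c‖ ≤ ε) :
    ‖∫ x, e x • u x ∂m - c‖ ≤ ε := by
  have hc : c = ∫ x, e x • c ∂m := by rw [integral_smul_const, he, one_smul]
  nth_rewrite 1 [hc]
  rw [← integral_sub hu ((L1.integrable_coeFn e).smul_const c)]
  calc ‖∫ x, (e x • u x - e x • c) ∂m‖ ≤ ∫ x, ‖e x‖ * ε ∂m := by
        refine norm_integral_le_of_norm_le ((L1.integrable_coeFn e).norm.mul_const _)
          (h.mono fun x hx => ?_)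
        rw [← smul_sub, norm_smul]
        by_cases h0 : e x = 0
        · simp [h0]
        · exact mul_le_mul_of_nonneg_left (hx h0) (norm_nonneg _)
    _ = ‖e‖ * ε := by rw [integral_mul_const, L1.norm_eq_integral_norm]
    _ ≤ ε := mul_le_of_le_one_left hε he1

section Action

open ZeroAtInftyContinuousMap

variable {G : Type*} [Group G] [TopologicalSpace G] [IsTopologicalGroup G] [LocallyCompactSpace G]
  [T2Space G] [MeasurableSpace G] [BorelSpace G] {ν : Measure G} [ν.Regular]

lemma integrable_smul_rightTranslate {k : G → ℂ} (hk : Integrable k ν) (h : C₀(G, ℂ)) :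
    Integrable (fun x => k x • h.rightTranslate x) ν :=
  hk.smul_of_continuous_of_bound h.continuous_rightTranslate h.norm_rightTranslate_le

/-- The action of `L¹(ν)` on `C₀(G)` given by `(k, h) ↦ ∫ k(x) h(· x) dν(x)`, a Bochner integral
in `C₀(G)`. -/
def actionC₀ (ν : Measure G) [ν.Regular] : Lp ℂ 1 ν →L[ℂ] C₀(G, ℂ) →L[ℂ] C₀(G, ℂ) :=
  LinearMap.mkContinuous₂
    (LinearMap.mk₂ ℂ (fun (k : Lp ℂ 1 ν) (h : C₀(G, ℂ)) => ∫ x, k x • h.rightTranslate x ∂ν)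
      (fun k k' h => by
        rw [← integral_add (integrable_smul_rightTranslate (L1.integrable_coeFn k) h)
          (integrable_smul_rightTranslate (L1.integrable_coeFn k') h)]
        refine integral_congr_ae ((Lp.coeFn_add k k').mono fun x hx => ?_)
        change (k + k' : Lp ℂ 1 ν) x • _ = _
        rw [hx]
        exact add_smul (k x) (k' x) (h.rightTranslate x))
      (fun c k h => by
        rw [← integral_smul]
        refine integral_congr_ae ((Lp.coeFn_smul c k).mono fun x hx => ?_)
        change (c • k : Lp ℂ 1 ν) x • _ = _
        rw [hx]
        exact smul_assoc c (k x) (h.rightTranslate x))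
      (fun k h h' => by
        rw [← integral_add (integrable_smul_rightTranslate (L1.integrable_coeFn k) h)
          (integrable_smul_rightTranslate (L1.integrable_coeFn k) h')]
        refine integral_congr_ae (Eventually.of_forall fun x => ?_)
        exact smul_add (k x) (h.rightTranslate x) (h'.rightTranslate x))
      (fun c k h => by
        rw [← integral_smul]
        refine integral_congr_ae (Eventually.of_forall fun x => ?_)
        exact smul_comm (k x) c (h.rightTranslate x)))
    1 fun k h => by
      rw [one_mul, L1.norm_eq_integral_norm, ← integral_mul_const]
      refine norm_integral_le_of_norm_le ((L1.integrable_coeFn k).norm.mul_const _)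
        (Eventually.of_forall fun x => ?_)
      rw [norm_smul]
      exact mul_le_mul_of_nonneg_left (h.norm_rightTranslate_le x) (norm_nonneg _)

lemma actionC₀_apply (k : Lp ℂ 1 ν) (h : C₀(G, ℂ)) :
    actionC₀ ν k h = ∫ x, k x • h.rightTranslate x ∂ν := rfl

lemma norm_actionC₀_apply_le (k : Lp ℂ 1 ν) (h : C₀(G, ℂ)) :
    ‖actionC₀ ν k h‖ ≤ ‖k‖ * ‖h‖ := by
  rw [actionC₀_apply, L1.norm_eq_integral_norm, ← integral_mul_const]
  refine norm_integral_le_of_norm_le ((L1.integrable_coeFn k).norm.mul_const _)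
    (Eventually.of_forall fun x => ?_)
  rw [norm_smul]
  exact mul_le_mul_of_nonneg_left (h.norm_rightTranslate_le x) (norm_nonneg _)

lemma norm_actionC₀_le (k : Lp ℂ 1 ν) : ‖actionC₀ ν k‖ ≤ ‖k‖ :=
  ContinuousLinearMap.opNorm_le_bound _ (norm_nonneg _) (norm_actionC₀_apply_le k)

lemma actionC₀_apply_apply (k : Lp ℂ 1 ν) (h : C₀(G, ℂ)) (y : G) :
    actionC₀ ν k h y = ∫ x, h (y * x) * k x ∂ν := by
  rw [actionC₀_apply, ← evalCLM_apply, ← ContinuousLinearMap.integral_comp_comm _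
    (integrable_smul_rightTranslate (L1.integrable_coeFn k) h)]
  refine integral_congr_ae (Eventually.of_forall fun x => ?_)
  simp [mul_comm]

variable [ν.IsMulLeftInvariant]

lemma rightTranslate_actionC₀ (k : Lp ℂ 1 ν) (h : C₀(G, ℂ)) (u : G) :
    (actionC₀ ν k h).rightTranslate u = actionC₀ ν (translateL1 ν u k) h := by
  refine ZeroAtInftyContinuousMap.ext fun y => ?_
  rw [rightTranslate_apply, actionC₀_apply_apply, actionC₀_apply_apply,
    integral_mul_translateL1 (fun x => h (y * x))]
  simp only [mul_assoc]

/-- The normalised indicator function of a small neighbourhood of `1` is an approximate unit. -/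
lemma exists_approximate_unit [ν.IsOpenPosMeasure] (a : Lp ℂ 1 ν) (h : C₀(G, ℂ)) {ε : ℝ}
    (hε : 0 < ε) :
    ∃ e : Lp ℂ 1 ν, ‖e‖ ≤ 1 ∧ ‖actionC₀ ν e * actionC₀ ν a - actionC₀ ν a‖ ≤ ε ∧
      ‖actionC₀ ν e h - h‖ ≤ ε := by
  have h1 : ∀ᶠ u in 𝓝 (1 : G), ‖translateL1 ν u a - a‖ < ε := by
    have := (continuous_translateL1 a).tendsto 1
    rw [translateL1_one] at this
    simpa [dist_eq_norm] using Metric.tendsto_nhds.1 this ε hε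
  have h2 : ∀ᶠ u in 𝓝 (1 : G), ‖h.rightTranslate u - h‖ < ε := by
    have := h.continuous_rightTranslate.tendsto 1
    have h1 : h.rightTranslate 1 = h := ZeroAtInftyContinuousMap.ext fun y => by simp
    rw [h1] at this
    simpa [dist_eq_norm] using Metric.tendsto_nhds.1 this ε hε
  obtain ⟨V, ⟨hV, hVc⟩, hVε⟩ := (compact_basis_nhds (1 : G)).mem_iff.1 (h1.and h2)
  have hVm : MeasurableSet V := hVc.isClosed.measurableSet
  have hVt : ν V ≠ ∞ := hVc.measure_lt_top.ne
  have hV0 : 0 < ν.real V := ENNReal.toReal_pos (Measure.measure_pos_of_mem_nhds ν hV).ne' hVt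
  let e : Lp ℂ 1 ν := indicatorConstLp 1 hVm hVt ((ν.real V)⁻¹ : ℂ)
  have heV : e =ᵐ[ν] V.indicator fun _ => ((ν.real V)⁻¹ : ℂ) := indicatorConstLp_coeFn
  have he1 : ‖e‖ ≤ 1 := by
    rw [norm_indicatorConstLp one_ne_zero ENNReal.one_ne_top]
    simp [abs_of_pos hV0, inv_mul_cancel₀ hV0.ne']
  have hei : ∫ x, e x ∂ν = 1 := by
    rw [integral_congr_ae heV, integral_indicator hVm, setIntegral_const]
    simp [hV0.ne']
  have hmem : ∀ᵐ x ∂ν, e x ≠ 0 → x ∈ V := heV.mono fun x hx h0 => by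
    by_contra hxV
    exact h0 (by rw [hx, indicator_of_notMem hxV])
  refine ⟨e, he1, ContinuousLinearMap.opNorm_le_bound _ hε.le fun g => ?_, ?_⟩
  · refine norm_integral_smul_sub_le hei he1
      (integrable_smul_rightTranslate (L1.integrable_coeFn e) (actionC₀ ν a g))
      (mul_nonneg hε.le (norm_nonneg g)) (hmem.mono fun x hx h0 => ?_)
    have hsub : actionC₀ ν (translateL1 ν x a - a) g =
        actionC₀ ν (translateL1 ν x a) g - actionC₀ ν a g := by
      rw [map_sub]
      rfl
    change ‖(actionC₀ ν a g).rightTranslate x - actionC₀ ν a g‖ ≤ _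
    rw [rightTranslate_actionC₀, ← hsub]
    exact (norm_actionC₀_apply_le _ _).trans
      (mul_le_mul_of_nonneg_right (hVε (hx h0)).1.le (norm_nonneg _))
  · exact norm_integral_smul_sub_le hei he1
      (integrable_smul_rightTranslate (L1.integrable_coeFn e) h) hε.le
      (hmem.mono fun x hx h0 => (hVε (hx h0)).2.le)

/-- `C₀(G)` factorizes through the action of `L¹(ν)`. -/
lemma exists_actionC₀_eq [ν.IsOpenPosMeasure] (h : C₀(G, ℂ)) :
    ∃ (a : Lp ℂ 1 ν) (f : C₀(G, ℂ)), actionC₀ ν a f = h :=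
  exists_cohen_factorization (actionC₀ ν) norm_actionC₀_le
    (fun a x _ hε => exists_approximate_unit a x hε) h

end Action

/-! ### Convolution with absolutely continuous measures -/

section Density

variable {X : Type*} [TopologicalSpace X] [T2Space X] [LocallyCompactSpace X] [MeasurableSpace X]
  [BorelSpace X] {m : Measure X} [m.Regular]

namespace RegularComplexMeasure

/-- The embedding of `L¹(m)` into `M(X)`. -/
def ofL1 (m : Measure X) [m.Regular] (k : Lp ℂ 1 m) : RegularComplexMeasure X :=
  ofDensity m k (L1.integrable_coeFn k)

lemma exists_eq_ofL1 {μ : RegularComplexMeasure X} (h : μ.tv ≪ m) : ∃ k, μ = ofL1 m k := by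
  obtain ⟨p, hp, rfl⟩ := μ.exists_eq_ofDensity m h
  exact ⟨hp.toL1 p, ofDensity_congr _ _ hp.coeFn_toL1.symm⟩

lemma integral_ofL1 (k : Lp ℂ 1 m) (g : C₀(X, ℂ)) :
    (ofL1 m k).integral g = ∫ x, g x * k x ∂m :=
  integral_ofDensity _ (integrable_C₀ _ g)

end RegularComplexMeasure

namespace GeneralisedFunction

open RegularComplexMeasure

lemma pairing_ofL1_add (f : GeneralisedFunction X) (k k' : Lp ℂ 1 m) :
    f.pairing (ofL1 m (k + k')) = f.pairing (ofL1 m k) + f.pairing (ofL1 m k') := by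
  have hk := L1.integrable_coeFn k
  have hk' := L1.integrable_coeFn k'
  -- All three coordinates of `f` are restrictions of the one at `(|k| + |k'|) m`.
  have hτ : Integrable (fun x => ((‖k x‖ + ‖k' x‖ : ℝ) : ℂ)) m := (hk.norm.add hk'.norm).ofReal
  have h0 {x : X} (hx : ((‖k x‖ + ‖k' x‖ : ℝ) : ℂ) = 0) : k x = 0 ∧ k' x = 0 := by
    rw [Complex.ofReal_eq_zero, add_eq_zero_iff_of_nonneg (norm_nonneg _) (norm_nonneg _)] at hx
    simpa using hx
  have hτk : (ofL1 m k).tv ≪ (ofDensity m _ hτ).tv :=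
    tv_ofDensity_absolutelyContinuous_tv hk hτ (Eventually.of_forall fun x hx => (h0 hx).1)
  have hτk' : (ofL1 m k').tv ≪ (ofDensity m _ hτ).tv :=
    tv_ofDensity_absolutelyContinuous_tv hk' hτ (Eventually.of_forall fun x hx => (h0 hx).2)
  have hadd : ofL1 m (k + k') = ofDensity m (fun x => k x + k' x) (hk.add hk') :=
    ofDensity_congr _ _ (Lp.coeFn_add k k')
  have hτs : (ofDensity m (fun x => k x + k' x) (hk.add hk')).tv ≪ (ofDensity m _ hτ).tv :=
    tv_ofDensity_absolutelyContinuous_tv _ hτ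
      (Eventually.of_forall fun x hx => by simp [(h0 hx).1, (h0 hx).2])
  rw [hadd, f.pairing_ofDensity _ hτs, ofL1, f.pairing_ofDensity _ hτk, ofL1,
    f.pairing_ofDensity _ hτk', ← integral_add]
  · simp only [mul_add]
  · exact integrable_mul_of_integrable_tv _ (f.integrable_toFun hτk)
  · exact integrable_mul_of_integrable_tv _ (f.integrable_toFun hτk')

lemma pairing_ofL1_smul (f : GeneralisedFunction X) (c : ℂ) (k : Lp ℂ 1 m) :
    f.pairing (ofL1 m (c • k)) = c * f.pairing (ofL1 m k) := by
  have hk := L1.integrable_coeFn k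
  have hsmul : ofL1 m (c • k) = ofDensity m (fun x => c * k x) (hk.const_mul c) :=
    ofDensity_congr _ _ (Lp.coeFn_smul c k)
  have hac : (ofDensity m (fun x => c * k x) (hk.const_mul c)).tv ≪ (ofL1 m k).tv :=
    tv_ofDensity_absolutelyContinuous_tv _ hk (Eventually.of_forall fun x hx => by simp [hx])
  rw [hsmul, f.pairing_ofDensity _ hac]
  conv_rhs => rw [ofL1, f.pairing_ofDensity hk (ν := ofL1 m k) Measure.AbsolutelyContinuous.rfl]
  rw [← integral_const_mul]
  exact MeasureTheory.integral_congr_ae (Eventually.of_forall fun x => mul_left_comm _ _ _)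

lemma norm_pairing_ofL1_le (f : GeneralisedFunction X) (k : Lp ℂ 1 m) {K : Set X}
    (hK : MeasurableSet K) {C ε : ℝ} (hC : 0 ≤ C) (hε : 0 ≤ ε)
    (h : ∀ᵐ x ∂(ofL1 m k).tv, ‖f.toFun (ofL1 m k) x‖ ≤ C)
    (hKε : ∀ᵐ x ∂(ofL1 m k).tv, x ∉ K → ‖f.toFun (ofL1 m k) x‖ ≤ ε) :
    ‖f.pairing (ofL1 m k)‖ ≤ ε * ‖k‖ + C * ∫ x, K.indicator (fun x => ‖k x‖) x ∂m := by
  have hk := L1.integrable_coeFn k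
  have hkK := hk.norm.indicator hK
  rw [ofL1, ae_tv_ofDensity_iff hk] at h hKε
  conv_lhs => rw [ofL1, f.pairing_ofDensity hk (ν := ofL1 m k) Measure.AbsolutelyContinuous.rfl]
  rw [L1.norm_eq_integral_norm, ← integral_const_mul, ← integral_const_mul,
    ← integral_add (hk.norm.const_mul ε) (hkK.const_mul C)]
  refine norm_integral_le_of_norm_le ((hk.norm.const_mul ε).add (hkK.const_mul C)) ?_
  filter_upwards [h, hKε] with x hx hxε
  rw [norm_mul]
  by_cases h0 : k x = 0
  · simp only [h0, norm_zero, mul_zero, zero_add]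
    exact mul_nonneg hC (indicator_nonneg (fun _ _ => norm_nonneg _) x)
  by_cases hxK : x ∈ K
  · rw [indicator_of_mem hxK]
    have := mul_le_mul_of_nonneg_right (hx h0) (norm_nonneg (k x))
    have := mul_nonneg hε (norm_nonneg (k x))
    exact le_add_of_nonneg_of_le this ‹_›
  · rw [indicator_of_notMem hxK, mul_zero, add_zero]
    exact mul_le_mul_of_nonneg_right (hxε h0 hxK) (norm_nonneg _)

/-- A generalised function that vanishes at infinity restricts to a bounded functional on `L¹(m)`,
which is small on functions concentrated far out. -/
lemma exists_functional {f : GeneralisedFunction X} (hf : f ∈ vanishingAtInfinity X)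
    (m : Measure X) [m.Regular] :
    ∃ F : Lp ℂ 1 m →L[ℂ] ℂ, (∀ k, F k = f.pairing (ofL1 m k)) ∧
      ∃ C : ℝ, 0 ≤ C ∧ ∀ ε : ℝ, 0 < ε → ∃ K : Set X, IsCompact K ∧
        ∀ k : Lp ℂ 1 m, ‖F k‖ ≤ ε * ‖k‖ + C * ∫ x, K.indicator (fun x => ‖k x‖) x ∂m := by
  obtain ⟨C, hC, hCf⟩ := exists_bound hf m
  have hb (k : Lp ℂ 1 m) : ∀ᵐ x ∂(ofL1 m k).tv, ‖f.toFun (ofL1 m k) x‖ ≤ C :=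
    (ae_tv_ofDensity_iff _).2 (hCf k (L1.integrable_coeFn k))
  let F : Lp ℂ 1 m →ₗ[ℂ] ℂ :=
    { toFun := fun k => f.pairing (ofL1 m k)
      map_add' := f.pairing_ofL1_add
      map_smul' := f.pairing_ofL1_smul }
  refine ⟨F.mkContinuous C fun k => ?_, fun k => rfl, C, hC, fun ε hε => ?_⟩
  · have h := f.norm_pairing_ofL1_le k MeasurableSet.empty hC hC (hb k)
      ((hb k).mono fun x hx _ => hx)
    simp only [indicator_empty, integral_zero, mul_zero, add_zero] at h
    exact h
  · obtain ⟨K, hK, hKf⟩ := hf ε hε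
    exact ⟨K, hK, fun k => f.norm_pairing_ofL1_le k hK.measurableSet hC hε.le (hb k)
      ((hKf _).mono fun x hx hxK => (hx hxK).le)⟩

end GeneralisedFunction

/-- An integrable function is concentrated on a compact set up to a small error. -/
lemma exists_isCompact_integral_indicator_compl_le {k : X → ℂ} (hk : Integrable k m) {ε : ℝ}
    (hε : 0 < ε) :
    ∃ Q : Set X, IsCompact Q ∧ ∫ x, Qᶜ.indicator (fun x => ‖k x‖) x ∂m ≤ ε := by
  have := regular_withDensity_enorm hk
  have := isFiniteMeasure_withDensity_enorm hk
  obtain ⟨Q, -, hQ, hQε⟩ := MeasurableSet.univ.exists_isCompact_sdiff_lt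
    (measure_ne_top (m.withDensity fun x => ‖k x‖ₑ) univ) (ENNReal.ofReal_pos.2 hε).ne'
  refine ⟨Q, hQ, ?_⟩
  have hQm := hQ.measurableSet.compl
  rw [← compl_eq_univ_sdiff, withDensity_apply _ hQm] at hQε
  rw [integral_indicator hQm, integral_norm_eq_lintegral_enorm hk.aestronglyMeasurable.restrict]
  exact ENNReal.toReal_le_of_le_ofReal hε.le hQε.le

end Density

section Translation

variable {G : Type*} [Group G] [TopologicalSpace G] [IsTopologicalGroup G] [MeasurableSpace G]
  [BorelSpace G] {ν : Measure G} [ν.IsMulLeftInvariant]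

/-- The `L¹`-mass of a translate of `k` on a compact set `K` is small if the translate moves `K` off
the set where `k` is concentrated. -/
lemma integral_indicator_translateL1_le (k : Lp ℂ 1 ν) {K Q : Set G} (hQ : MeasurableSet Q)
    {y : G} (hy : ∀ q ∈ Q, y * q ∉ K) :
    ∫ x, K.indicator (fun x => ‖translateL1 ν y k x‖) x ∂ν ≤
      ∫ x, Qᶜ.indicator (fun x => ‖k x‖) x ∂ν := by
  rw [← integral_mul_left_eq_self _ y]
  have h := (measurePreserving_mul_left ν y).quasiMeasurePreserving.ae_eq (coeFn_translateL1 y k)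
  refine integral_mono_of_nonneg
    (Eventually.of_forall fun x => indicator_nonneg (fun _ _ => norm_nonneg _) _)
    ((L1.integrable_coeFn k).norm.indicator hQ.compl) (h.mono fun x hx => ?_)
  simp only [Function.comp_def, inv_mul_cancel_left] at hx
  by_cases hxQ : x ∈ Q
  · simp [hxQ, hy x hxQ]
  · rw [indicator_of_mem (mem_compl hxQ), ← hx]
    exact indicator_le_self' (fun _ _ => norm_nonneg _) _

end Translation

section Convolution

open ZeroAtInftyContinuousMap RegularComplexMeasure GeneralisedFunction

variable {G : Type*} [Group G] [TopologicalSpace G] [IsTopologicalGroup G] [LocallyCompactSpace G]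
  [T2Space G] [MeasurableSpace G] [BorelSpace G] {ν : Measure G} [ν.Regular]
  [ν.IsMulLeftInvariant]

/-- The function `y ↦ ⟨f, δ_y * k⟩` belongs to `C₀(G)`. -/
lemma exists_C₀_pairing_translateL1 {f : GeneralisedFunction G} (hf : f ∈ vanishingAtInfinity G)
    (k : Lp ℂ 1 ν) :
    ∃ h : C₀(G, ℂ), ∀ y, h y = f.pairing (ofL1 ν (translateL1 ν y k)) := by
  obtain ⟨F, hF, C, hC, hFC⟩ := exists_functional hf ν
  refine ⟨⟨⟨fun y => F (translateL1 ν y k), F.continuous.comp (continuous_translateL1 k)⟩, ?_⟩,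
    fun y => hF _⟩
  refine Metric.tendsto_nhds.2 fun ε hε => ?_
  obtain ⟨K, hK, hKF⟩ := hFC (ε / 3 / (‖k‖ + 1)) (by positivity)
  obtain ⟨Q, hQ, hQk⟩ := exists_isCompact_integral_indicator_compl_le (L1.integrable_coeFn k)
    (ε := ε / 3 / (C + 1)) (by positivity)
  refine mem_cocompact.2 ⟨K * Q⁻¹, hK.mul hQ.inv, fun y hy => ?_⟩
  have hmass := integral_indicator_translateL1_le k (K := K) hQ.measurableSet (y := y)
    fun q hq hyq => hy ⟨y * q, hyq, q⁻¹, inv_mem_inv.2 hq, by simp⟩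
  have h1 : ε / 3 / (‖k‖ + 1) * ‖k‖ ≤ ε / 3 := by
    rw [div_mul_eq_mul_div]
    exact div_le_of_le_mul₀ (by positivity) (by positivity) (by nlinarith)
  have h2 : C * (ε / 3 / (C + 1)) ≤ ε / 3 := by
    rw [mul_div_assoc']
    exact div_le_of_le_mul₀ (by positivity) (by positivity) (by nlinarith)
  have h3 := hKF (translateL1 ν y k)
  rw [LinearIsometry.norm_map] at h3
  have h4 := mul_le_mul_of_nonneg_left (hmass.trans hQk) hC
  change dist (F (translateL1 ν y k)) 0 < ε
  rw [dist_zero_right]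
  linarith

/-- For `μ ∈ M(G)` and `k ∈ L¹(ν)` the Bochner integral `∫ δ_x * k dμ(x)` in `L¹(ν)` is the
convolution `μ * k`, whichever order of integration is used to define it. Continuity of
`k ↦ ⟨f, k⟩` on `L¹(ν)` then gives `⟨f, μ * k⟩ = ∫ ⟨f, δ_x * k⟩ dμ(x)`. -/
lemma exists_convolution_pairing_eq (k : Lp ℂ 1 ν) (μ : RegularComplexMeasure G) :
    ∃ ρ : RegularComplexMeasure G,
      (∀ g : C₀(G, ℂ),
        ρ.integral g = μ.integral fun x => (ofL1 ν k).integral fun y => g (x * y)) ∧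
      (∀ g : C₀(G, ℂ),
        ρ.integral g = (ofL1 ν k).integral fun y => μ.integral fun x => g (x * y)) ∧
      ∀ f ∈ vanishingAtInfinity G, ∀ h : C₀(G, ℂ),
        (∀ y, h y = f.pairing (ofL1 ν (translateL1 ν y k))) →
          (ofC₀ h).pairing μ = f.pairing ρ := by
  obtain ⟨p, hp, hμ⟩ := μ.exists_eq_ofDensity μ.tv Measure.AbsolutelyContinuous.rfl
  have hμint (h : C₀(G, ℂ)) : μ.integral h = ∫ x, p x * h x ∂μ.tv := by
    conv_lhs => rw [hμ]
    rw [integral_ofDensity hp (integrable_C₀ _ h)]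
    simp only [mul_comm]
  have hint : Integrable (fun x => p x • translateL1 ν x k) μ.tv :=
    hp.smul_of_continuous_of_bound (continuous_translateL1 k) (C := ‖k‖)
      fun x => (LinearIsometry.norm_map _ k).le
  have key (f : GeneralisedFunction G) (hf : f ∈ vanishingAtInfinity G) (h : C₀(G, ℂ))
      (hh : ∀ y, h y = f.pairing (ofL1 ν (translateL1 ν y k))) :
      f.pairing (ofL1 ν (∫ x, p x • translateL1 ν x k ∂μ.tv)) = μ.integral h := by
    obtain ⟨F, hF, -⟩ := exists_functional hf ν
    rw [← hF, ← ContinuousLinearMap.integral_comp_comm _ hint, hμint]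
    refine MeasureTheory.integral_congr_ae (Eventually.of_forall fun x => ?_)
    simp only [hh, ← hF]
    exact map_smul F (p x) _
  have htrans (g : C₀(G, ℂ)) (x : G) :
      (ofC₀ g).pairing (ofL1 ν (translateL1 ν x k)) = ∫ y, g (x * y) * k y ∂ν := by
    rw [pairing_ofC₀, integral_ofL1, integral_mul_translateL1 g]
  have hk (g : C₀(G, ℂ)) (x : G) :
      (ofL1 ν k).integral (fun y => g (x * y)) = ∫ y, g (x * y) * k y ∂ν :=
    integral_ofL1 k (g.leftTranslate x)
  have hfst (g : C₀(G, ℂ)) : (ofL1 ν (∫ x, p x • translateL1 ν x k ∂μ.tv)).integral g =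
      ∫ x, p x * ∫ y, g (x * y) * k y ∂ν ∂μ.tv := by
    obtain ⟨h, hh⟩ := exists_C₀_pairing_translateL1 (ofC₀_mem_vanishingAtInfinity g) k
    rw [← pairing_ofC₀, key _ (ofC₀_mem_vanishingAtInfinity g) h hh, hμint]
    simp only [hh, htrans]
  refine ⟨ofL1 ν (∫ x, p x • translateL1 ν x k ∂μ.tv), fun g => ?_, fun g => ?_,
    fun f hf h hh => ?_⟩
  · obtain ⟨h, hh⟩ := exists_C₀_pairing_translateL1 (ofC₀_mem_vanishingAtInfinity g) k
    have : (fun x => (ofL1 ν k).integral fun y => g (x * y)) = h := by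
      funext x
      rw [hh, htrans, hk]
    rw [this, ← pairing_ofC₀, key _ (ofC₀_mem_vanishingAtInfinity g) h hh]
  · -- The inner integral, as a function of `y`, is the Bochner integral `L` in `C₀(G)`.
    have hL := hp.smul_of_continuous_of_bound g.continuous_leftTranslate g.norm_leftTranslate_le
    set L : C₀(G, ℂ) := ∫ x, p x • g.leftTranslate x ∂μ.tv with hLdef
    have hinner : (fun y => μ.integral fun x => g (x * y)) = L := by
      funext y
      rw [hLdef, ← evalCLM_apply, ← ContinuousLinearMap.integral_comp_comm _ hL]
      exact hμint (g.rightTranslate y)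
    let Φ : C₀(G, ℂ) →L[ℂ] ℂ := (evalCLM 1).comp (actionC₀ ν k)
    have hΦ (u : C₀(G, ℂ)) : Φ u = ∫ y, u y * k y ∂ν := by
      refine (actionC₀_apply_apply k u 1).trans ?_
      simp only [one_mul]
    rw [hfst, hinner, integral_ofL1 k L, ← hΦ, hLdef,
      ← ContinuousLinearMap.integral_comp_comm _ hL]
    refine MeasureTheory.integral_congr_ae (Eventually.of_forall fun x => ?_)
    change p x * ∫ y, g.leftTranslate x y * k y ∂ν = Φ (p x • g.leftTranslate x)
    rw [← hΦ]
    exact (map_smul Φ (p x) _).symm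
  · rw [pairing_ofC₀, key f hf h hh]

/-- For `σ` absolutely continuous and `f` vanishing at infinity, the functional `μ ↦ ⟨f, μ * σ⟩` is
given by a function in `C₀(G)`. -/
lemma exists_C₀_pairing_convolution {σ : RegularComplexMeasure G} (hσ : σ.tv ≪ ν)
    {f : GeneralisedFunction G} (hf : f ∈ vanishingAtInfinity G) :
    ∃ h : C₀(G, ℂ), ∀ μ : RegularComplexMeasure G, ∃ ρ : RegularComplexMeasure G,
      (∀ g : C₀(G, ℂ), ρ.integral g = μ.integral fun x => σ.integral fun y => g (x * y)) ∧
      (∀ g : C₀(G, ℂ), ρ.integral g = σ.integral fun y => μ.integral fun x => g (x * y)) ∧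
      (ofC₀ h).pairing μ = f.pairing ρ := by
  obtain ⟨k, rfl⟩ := exists_eq_ofL1 hσ
  obtain ⟨h, hh⟩ := exists_C₀_pairing_translateL1 hf k
  refine ⟨h, fun μ => ?_⟩
  obtain ⟨ρ, h1, h2, h3⟩ := exists_convolution_pairing_eq k μ
  exact ⟨ρ, h1, h2, h3 f hf h hh⟩

/-- Every function in `C₀(G)` arises as in `exists_C₀_pairing_convolution`, even with `f` in
`C₀(G)`. -/
lemma exists_pairing_convolution_eq [ν.IsOpenPosMeasure] (h : C₀(G, ℂ)) :
    ∃ σ : RegularComplexMeasure G, σ.tv ≪ ν ∧ ∃ f ∈ vanishingAtInfinity G,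
      ∀ μ : RegularComplexMeasure G, ∃ ρ : RegularComplexMeasure G,
        (∀ g : C₀(G, ℂ), ρ.integral g = μ.integral fun x => σ.integral fun y => g (x * y)) ∧
        (∀ g : C₀(G, ℂ), ρ.integral g = σ.integral fun y => μ.integral fun x => g (x * y)) ∧
        (ofC₀ h).pairing μ = f.pairing ρ := by
  obtain ⟨a, u, rfl⟩ := exists_actionC₀_eq (ν := ν) h
  refine ⟨ofL1 ν a, tv_ofDensity_absolutelyContinuous _, ofC₀ u, ofC₀_mem_vanishingAtInfinity u,
    fun μ => ?_⟩
  obtain ⟨ρ, h1, h2, h3⟩ := exists_convolution_pairing_eq a μ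
  refine ⟨ρ, h1, h2, h3 _ (ofC₀_mem_vanishingAtInfinity u) _ fun y => ?_⟩
  rw [pairing_ofC₀, integral_ofL1, integral_mul_translateL1 u, actionC₀_apply_apply]

end Convolution

/-! ### Left and right Haar measure -/

section Invariant

variable {G : Type*} [Group G] [TopologicalSpace G] [IsTopologicalGroup G] [LocallyCompactSpace G]
  [T2Space G] [MeasurableSpace G] [BorelSpace G]

/-- A left invariant measure has, on compact sets, a density with respect to a right invariant one,
so it vanishes on compact sets which are null for the latter. -/
lemma measure_eq_zero_of_isMulRightInvariant {μ ν : Measure G} [IsFiniteMeasureOnCompacts μ]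
    [μ.IsMulLeftInvariant] [ν.Regular] [ν.IsMulRightInvariant] [ν.IsOpenPosMeasure] {K : Set G}
    (hK : IsCompact K) (h : ν K = 0) : μ K = 0 := by
  -- The density of `μ` is the constant `∫ g ∂μ` times `D⁻¹`, which is bounded near `K`. The bound
  -- is applied to a bump function `f` which is `1` on `K` and vanishes outside an open set `U` with
  -- `ν U` small.
  obtain ⟨g, hgc, hg0, hg1⟩ := exists_continuous_nonneg_pos (1 : G)
  let D : G → ℝ := fun y => ∫ z, g (z⁻¹ * y) ∂ν
  have hD : Continuous D := continuous_integral_apply_inv_mul g.continuous hgc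
  have hD0 (x : G) : 0 < D x := by
    have hc : Continuous fun y => g (y⁻¹ * x) := by fun_prop
    refine (integral_pos_iff_support_of_nonneg (fun y => hg0 (y⁻¹ * x)) ?_).2 ?_
    · exact hc.integrable_of_hasCompactSupport
        (hgc.comp_homeomorph ((Homeomorph.inv G).trans (Homeomorph.mulRight x)))
    · exact hc.isOpen_support.measure_pos ν ⟨x, by simpa using hg1⟩
  obtain ⟨W, hW, hKW⟩ := exists_compact_superset hK
  obtain ⟨M, hM⟩ := hW.exists_bound_of_continuousOn
    (hD.inv₀ fun x => (hD0 x).ne').continuousOn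
  set c := ∫ x, g x ∂μ
  have hc : 0 ≤ c := integral_nonneg hg0
  have hreal : μ.real K ≤ 0 := by
    refine le_of_forall_pos_le_add fun ε hε => ?_
    rw [zero_add]
    have hδ : 0 < ε / (|M| * c + 1) := by positivity
    obtain ⟨U, hKU, hU, hUδ⟩ := K.exists_isOpen_lt_of_lt (μ := ν) (ENNReal.ofReal _)
      (by rw [h]; exact ENNReal.ofReal_pos.2 hδ)
    obtain ⟨f, hfK, hfU, hfc, hf⟩ := exists_continuous_one_zero_of_isCompact hK
      (hU.inter isOpen_interior).isClosed_compl
      (disjoint_compl_right_iff_subset.2 (subset_inter hKU hKW))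
    have hUt : ν (U ∩ interior W) ≠ ∞ :=
      ((measure_mono inter_subset_left).trans_lt (hUδ.trans_le le_top)).ne
    have hUm : MeasurableSet (U ∩ interior W) := (hU.inter isOpen_interior).measurableSet
    have hUr : ν.real (U ∩ interior W) ≤ ε / (|M| * c + 1) :=
      ENNReal.toReal_le_of_le_ofReal hδ.le ((measure_mono inter_subset_left).trans hUδ.le)
    have h1 : μ.real K ≤ ∫ x, f x ∂μ := by
      rw [← integral_indicator_one hK.measurableSet]
      refine integral_mono_of_nonneg
        (Eventually.of_forall fun x => indicator_nonneg (fun _ _ => zero_le_one) x)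
        (f.continuous.integrable_of_hasCompactSupport hfc) (Eventually.of_forall fun x => ?_)
      by_cases hx : x ∈ K
      · simp [hx, hfK hx]
      · simpa [hx] using (hf x).1
    have h2 : ∫ x, f x * (D x)⁻¹ ∂ν ≤ ε / (|M| * c + 1) * |M| := by
      calc ∫ x, f x * (D x)⁻¹ ∂ν ≤ ∫ x, (U ∩ interior W).indicator (fun _ => |M|) x ∂ν := by
            refine integral_mono_of_nonneg
              (Eventually.of_forall fun x => mul_nonneg (hf x).1 (inv_nonneg.2 (hD0 x).le))
              ((integrable_indicator_iff hUm).2 (integrableOn_const hUt))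
              (Eventually.of_forall fun x => ?_)
            by_cases hx : x ∈ U ∩ interior W
            · simp only [indicator_of_mem hx]
              calc f x * (D x)⁻¹ ≤ 1 * |M| :=
                    mul_le_mul (hf x).2
                      (((le_abs_self _).trans (hM x (interior_subset hx.2))).trans (le_abs_self M))
                      (inv_nonneg.2 (hD0 x).le) zero_le_one
                _ = |M| := one_mul _
            · simp [hx, hfU hx]
        _ = ν.real (U ∩ interior W) * |M| := by
            rw [integral_indicator hUm, setIntegral_const, smul_eq_mul]
        _ ≤ _ := mul_le_mul_of_nonneg_right hUr (abs_nonneg M)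
    calc μ.real K ≤ (∫ x, f x * (D x)⁻¹ ∂ν) * c :=
          h1.trans_eq (Measure.integral_isMulLeftInvariant_isMulRightInvariant_combo f.continuous
            hfc g.continuous hgc hg0 hg1)
      _ ≤ ε / (|M| * c + 1) * |M| * c := mul_le_mul_of_nonneg_right h2 hc
      _ ≤ ε := by
          rw [mul_assoc, div_mul_eq_mul_div]
          exact div_le_of_le_mul₀ (by positivity) hε.le
            (by nlinarith [mul_nonneg (abs_nonneg M) hc])
  exact (measureReal_eq_zero_iff hK.measure_lt_top.ne).1 (le_antisymm hreal measureReal_nonneg)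

/-- Absolute continuity of a finite regular measure can be tested on compact sets. -/
lemma absolutelyContinuous_of_isCompact {X : Type*} [TopologicalSpace X] [MeasurableSpace X]
    {τ μ ν : Measure X} [τ.Regular] [IsFiniteMeasure τ]
    (h : ∀ K, IsCompact K → ν K = 0 → μ K = 0) (hτ : τ ≪ μ) : τ ≪ ν := by
  refine Measure.AbsolutelyContinuous.mk fun s hs hs0 => ?_
  rw [hs.measure_eq_iSup_isCompact_of_ne_top (measure_ne_top τ s)]
  simp only [ENNReal.iSup_eq_zero]
  exact fun K hKs hK => hτ (h K hK (measure_mono_null hKs hs0))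

/-- `M_a(G)` does not depend on whether left or right Haar measure is used. -/
lemma absolutelyContinuous_inv_iff (haar : Measure G) [haar.IsHaarMeasure] [haar.Regular]
    {τ : Measure G} [τ.Regular] [IsFiniteMeasure τ] : τ ≪ haar.inv ↔ τ ≪ haar := by
  refine ⟨absolutelyContinuous_of_isCompact fun K hK h => ?_,
    absolutelyContinuous_of_isCompact fun K hK h => measure_eq_zero_of_isMulRightInvariant hK h⟩
  rw [Measure.inv_apply]
  refine measure_eq_zero_of_isMulRightInvariant (ν := haar.inv) hK.inv ?_
  rwa [Measure.inv_apply, inv_inv]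

end Invariant

/-! ### The opposite group -/

section Opposite

/-- The group structure on `G` with multiplication `(x, y) ↦ y x`, on the type `G` itself. -/
@[reducible]
def oppositeGroup (G : Type*) [Group G] : Group G :=
  @Group.ofLeftAxioms G ⟨fun x y => y * x⟩ ⟨fun x => x⁻¹⟩ ⟨1⟩ (fun x y z => (mul_assoc z y x).symm)
    mul_one mul_inv_cancel

variable {G : Type*} [Group G]

lemma isTopologicalGroup_oppositeGroup [TopologicalSpace G] [IsTopologicalGroup G] :
    @IsTopologicalGroup G _ (oppositeGroup G) :=
  @IsTopologicalGroup.mk G _ (oppositeGroup G)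
    (@ContinuousMul.mk G _ (oppositeGroup G).toMul (continuous_snd.mul continuous_fst))
    (@ContinuousInv.mk G _ (oppositeGroup G).toInv (continuous_inv (G := G)))

lemma isMulLeftInvariant_oppositeGroup [MeasurableSpace G] {ν : Measure G}
    [ν.IsMulRightInvariant] : @Measure.IsMulLeftInvariant G _ (oppositeGroup G).toMul ν :=
  @Measure.IsMulLeftInvariant.mk G _ (oppositeGroup G).toMul ν (map_mul_right_eq_self ν)

end Opposite

/-! ### The products `σ ∘ f` and `f ∘ σ` -/

namespace GeneralisedFunction

open RegularComplexMeasure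

variable {G : Type*} [Group G] [TopologicalSpace G] [LocallyCompactSpace G] [T2Space G]
  [MeasurableSpace G] [BorelSpace G] {σ : RegularComplexMeasure G} {f : GeneralisedFunction G}

lemma IsLeftProduct.unique {g g' : GeneralisedFunction G} (h : IsLeftProduct σ f g)
    (h' : IsLeftProduct σ f g') : g = g' := by
  refine eq_of_forall_pairing_eq fun μ => ?_
  obtain ⟨ρ, hρ, hg⟩ := h μ
  obtain ⟨ρ', hρ', hg'⟩ := h' μ
  rw [hg, hg', hρ.unique hρ']

lemma IsRightProduct.unique {g g' : GeneralisedFunction G} (h : IsRightProduct f σ g)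
    (h' : IsRightProduct f σ g') : g = g' := by
  refine eq_of_forall_pairing_eq fun μ => ?_
  obtain ⟨ρ, hρ, hg⟩ := h μ
  obtain ⟨ρ', hρ', hg'⟩ := h' μ
  rw [hg, hg', hρ.unique hρ']

variable [IsTopologicalGroup G] (haar : Measure G) [haar.IsHaarMeasure] [haar.Regular]

lemma exists_isRightProduct_ofC₀ (hσ : σ ∈ absolutelyContinuousMeasures haar)
    (hf : f ∈ vanishingAtInfinity G) : ∃ h, IsRightProduct f σ (ofC₀ h) := by
  obtain ⟨h, hh⟩ := exists_C₀_pairing_convolution (ν := haar) hσ hf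
  refine ⟨h, fun μ => ?_⟩
  obtain ⟨ρ, -, h1, h2⟩ := hh μ
  exact ⟨ρ, h1, h2⟩

lemma exists_isRightProduct_eq_ofC₀ (h : C₀(G, ℂ)) :
    ∃ f ∈ vanishingAtInfinity G, ∃ σ ∈ absolutelyContinuousMeasures haar,
      IsRightProduct f σ (ofC₀ h) := by
  obtain ⟨σ, hσ, f, hf, hh⟩ := exists_pairing_convolution_eq (ν := haar) h
  refine ⟨f, hf, σ, hσ, fun μ => ?_⟩
  obtain ⟨ρ, -, h1, h2⟩ := hh μ
  exact ⟨ρ, h1, h2⟩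

/-- This is the statement for `f ∘ σ` in the opposite group, whose left Haar measure is
`haar.inv`. -/
lemma exists_isLeftProduct_ofC₀ (hσ : σ ∈ absolutelyContinuousMeasures haar)
    (hf : f ∈ vanishingAtInfinity G) : ∃ h, IsLeftProduct σ f (ofC₀ h) := by
  obtain ⟨h, hh⟩ := @exists_C₀_pairing_convolution G (oppositeGroup G) _
    isTopologicalGroup_oppositeGroup _ _ _ _ haar.inv _ isMulLeftInvariant_oppositeGroup σ
    ((absolutelyContinuous_inv_iff haar).2 hσ) f hf
  refine ⟨h, fun μ => ?_⟩
  obtain ⟨ρ, h1, -, h2⟩ := hh μ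
  exact ⟨ρ, h1, h2⟩

/-- As for `exists_isLeftProduct_ofC₀`, pass to the opposite group. -/
lemma exists_isLeftProduct_eq_ofC₀ (h : C₀(G, ℂ)) :
    ∃ σ ∈ absolutelyContinuousMeasures haar, ∃ f ∈ vanishingAtInfinity G,
      IsLeftProduct σ f (ofC₀ h) := by
  obtain ⟨σ, hσ, f, hf, hh⟩ := @exists_pairing_convolution_eq G (oppositeGroup G) _
    isTopologicalGroup_oppositeGroup _ _ _ _ haar.inv _ isMulLeftInvariant_oppositeGroup _ h
  refine ⟨σ, (absolutelyContinuous_inv_iff haar).1 hσ, f, hf, fun μ => ?_⟩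
  obtain ⟨ρ, h1, -, h2⟩ := hh μ
  exact ⟨ρ, h1, h2⟩

end GeneralisedFunction

end

theorem proposition3p4 {G : Type*} [Group G] [TopologicalSpace G] [IsTopologicalGroup G]
    [LocallyCompactSpace G] [T2Space G] [MeasurableSpace G] [BorelSpace G]
    (haar : Measure G) [haar.IsHaarMeasure] [haar.Regular] :
    -- the products `σ ∘ f` and `f ∘ σ` are well defined
    (∀ σ ∈ RegularComplexMeasure.absolutelyContinuousMeasures haar,
      ∀ f ∈ GeneralisedFunction.vanishingAtInfinity G,
        (∃! g : GeneralisedFunction G, GeneralisedFunction.IsLeftProduct σ f g) ∧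
        (∃! g : GeneralisedFunction G, GeneralisedFunction.IsRightProduct f σ g)) ∧
    -- `M_a(G) ∘ GL₀(G) = C₀(G)`
    GeneralisedFunction.leftProducts (RegularComplexMeasure.absolutelyContinuousMeasures haar)
        (GeneralisedFunction.vanishingAtInfinity G) =
      Set.range (GeneralisedFunction.ofC₀ (G := G)) ∧
    -- `GL₀(G) ∘ M_a(G) = C₀(G)`
    GeneralisedFunction.rightProducts (GeneralisedFunction.vanishingAtInfinity G)
        (RegularComplexMeasure.absolutelyContinuousMeasures haar) =
      Set.range (GeneralisedFunction.ofC₀ (G := G)) := by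
  refine ⟨fun σ hσ f hf => ⟨?_, ?_⟩, Set.Subset.antisymm ?_ ?_, Set.Subset.antisymm ?_ ?_⟩
  · obtain ⟨h, hh⟩ := GeneralisedFunction.exists_isLeftProduct_ofC₀ haar hσ hf
    exact ⟨_, hh, fun g hg => hg.unique hh⟩
  · obtain ⟨h, hh⟩ := GeneralisedFunction.exists_isRightProduct_ofC₀ haar hσ hf
    exact ⟨_, hh, fun g hg => hg.unique hh⟩
  · rintro g ⟨σ, hσ, f, hf, hg⟩
    obtain ⟨h, hh⟩ := GeneralisedFunction.exists_isLeftProduct_ofC₀ haar hσ hf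
    exact ⟨h, hh.unique hg⟩
  · rintro _ ⟨h, rfl⟩
    exact GeneralisedFunction.exists_isLeftProduct_eq_ofC₀ haar h
  · rintro g ⟨f, hf, σ, hσ, hg⟩
    obtain ⟨h, hh⟩ := GeneralisedFunction.exists_isRightProduct_ofC₀ haar hσ hf
    exact ⟨h, hh.unique hg⟩
  · rintro _ ⟨h, rfl⟩
    exact GeneralisedFunction.exists_isRightProduct_eq_ofC₀ haar h
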